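/- A $4$-uniform loose cycle $\mathcal{C}^4_n$ of length $n$ is the $4$-uniform hypergraph with vertex set $\{v_1,\dots,v_{3n}\}$ and with the $n$ edges $e_i=\{v_{3i-2},v_{3i-1},v_{3i},v_{3i+1}\}$, $1\le i\le n$, where indices are taken modulo $3n$. For $4$-uniform hypergraphs $\mathcal{G}$ and $\mathcal{H}$, the Ramsey number $R(\mathcal{G},\mathcal{H})$ is the smallest positive integer $N$ such that every red-blue coloring of the edges of the complete $4$-uniform hypergraph $\mathcal{K}^4_N$ on $N$ vertices yields a red copy of $\mathcal{G}$ or a blue copy of $\mathcal{H}$. Let $n\ge 4$. If $n$ is odd, then $$R(\mathcal{C}^4_n,\mathcal{C}^4_n)=3n+\Big\lfloor\frac{n-1}{2}\Big\rfloor.$$ If $n$ is even, then $$3n+\Big\lfloor\frac{n-1}{2}\Big\rfloor\le R(\mathcal{C}^4_n,\mathcal{C}^4_n)\le 3n+\Big\lfloor\frac{n-1}{2}\Big\rfloor+1.$$ -/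

import Mathlib

namespace Hypergraph

/-- `K^k_N`: the complete `k`-uniform hypergraph on `N` vertices. Its edges are all
`k`-element subsets of the vertex set. -/
def completeUniform (k N : ℕ) : Hypergraph (Fin N) where
  vertexSet := Set.univ
  edgeSet := {e | e.ncard = k}
  subset_vertexSet_of_mem_edgeSet' := fun _ _ => Set.subset_univ _

/-- The sub-hypergraph of `H` formed by the edges of colour `b`, for a colouring `c` of the edges
of `H` with the two colours `true` (red) and `false` (blue). -/
def colorClass {α : Type*} (H : Hypergraph α) (c : H.edgeSet → Bool) (b : Bool) :
    Hypergraph α where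
  vertexSet := H.vertexSet
  edgeSet := {e | ∃ he : e ∈ H.edgeSet, c ⟨e, he⟩ = b}
  subset_vertexSet_of_mem_edgeSet' := fun _ he =>
    H.subset_vertexSet_of_mem_edgeSet' he.choose

/-- `H` contains a copy of `G`: there is an injection of the vertices of `G` into those of `H`
which maps every edge of `G` onto an edge of `H`. -/
def ContainsCopy {α β : Type*} (H : Hypergraph β) (G : Hypergraph α) : Prop :=
  ∃ f : α → β, Set.InjOn f G.vertexSet ∧ Set.MapsTo f G.vertexSet H.vertexSet ∧
    ∀ e ∈ G.edgeSet, f '' e ∈ H.edgeSet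

/-- Every red-blue colouring of the edges of `K^k_N` yields a red copy of `G` or a blue copy
of `H`. -/
def Arrows {α β : Type*} (k N : ℕ) (G : Hypergraph α) (H : Hypergraph β) : Prop :=
  ∀ c : (completeUniform k N).edgeSet → Bool,
    ((completeUniform k N).colorClass c true).ContainsCopy G ∨
      ((completeUniform k N).colorClass c false).ContainsCopy H

/-- The Ramsey number `R(G, H)` of two `k`-uniform hypergraphs: the smallest positive integer `N`
such that every red-blue colouring of the edges of `K^k_N` yields a red copy of `G` or a blue copy
of `H`. The value is `0` exactly when there is no such `N`. -/
noncomputable def ramseyNumber {α β : Type*} (k : ℕ) (G : Hypergraph α) (H : Hypergraph β) : ℕ :=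
  sInf {N : ℕ | 0 < N ∧ Arrows k N G H}

/-- A nonzero value of `ramseyNumber` is genuinely a minimum, never the default value of an
infimum over the empty set. -/
theorem ramseyNumber_isLeast {α β : Type*} {k : ℕ} {G : Hypergraph α} {H : Hypergraph β}
    (h : ramseyNumber k G H ≠ 0) :
    IsLeast {N : ℕ | 0 < N ∧ Arrows k N G H} (ramseyNumber k G H) :=
  ⟨Nat.sInf_mem (Nat.nonempty_of_pos_sInf (Nat.pos_of_ne_zero h)), fun _ hN => Nat.sInf_le hN⟩

/-- The `k`-uniform loose cycle `C^k_n` of length `n`: its `n * (k - 1)` vertices are numbered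
cyclically, and for `0 ≤ i < n` its `i`-th edge consists of the `k` consecutive vertices with the
numbers `i * (k - 1), i * (k - 1) + 1, …, i * (k - 1) + (k - 1)`. (Meant for `2 ≤ k`, `2 ≤ n`.) -/
def looseCycle (k n : ℕ) : Hypergraph (ZMod (n * (k - 1))) where
  vertexSet := Set.univ
  edgeSet := {e | ∃ i < n, e = {v | ∃ j < k, v = ((i * (k - 1) + j : ℕ) : ZMod (n * (k - 1)))}}
  subset_vertexSet_of_mem_edgeSet' := fun _ _ => Set.subset_univ _

end Hypergraph

/-! Lower bound: on fewer than `3 * n + (n - 1) / 2` vertices, colour an edge red when it avoids the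
first `(n - 1) / 2` vertices. A red cycle has too few vertices at its disposal. In a blue cycle
every edge meets the small set, but a vertex of a loose cycle lies in at most two edges, so at most
`2 * ((n - 1) / 2) < n` edges can be met.

Upper bound: `3 * n + n / 2` vertices suffice. This equals the lower bound for odd `n` and exceeds
it by one for even `n`. Monochromatic cycles are lengthened one edge at a time, starting from a
triangle (`exists_mono_three`). Call the colour of the current cycle, of length `m`, red, and
suppose that no red cycle has length `m + 1`. Then no stretch of `l` edges can be rerouted through
`l + 1` red edges (`IsCyc.not_loosePath`), which forces many blue edges between the cycle and the
set `W` of outside vertices. Writing `m = 2 * r + 1` or `m = 2 * r + 2`, one has `r + 4 ≤ W.card`.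

The engine is `exists_block`: over two consecutive red edges, almost any two vertices of `W` are
joined by a blue path of two edges. It spares one of the first three vertices of the block and may
borrow one of the first three of the next block. Since the spared vertex is the one lent to the
block before, `r` such links fit together into a blue path with `2 * r` edges
(`IsCyc.exists_chain`). It remains to close this path by two blue edges (odd `m`) or three (even
`m`) around the unused end of the cycle. If that is impossible, the red edges forced there give a
red rerouting after all. -/

namespace LooseRamsey

/-! ### Loose paths and cycles: gluing, symmetry, rerouting -/

variable {V : Type*} [DecidableEq V]

/-- There is a loose path with `n` edges of colour `c` from `x` to `y`, all of whose inner vertices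
lie in `S`. Its vertices are `f 0, …, f (3 * n)`. -/
def LoosePath (c : Finset V → Prop) (n : ℕ) (x y : V) (S : Set V) : Prop :=
  ∃ f : ℕ → V, f 0 = x ∧ f (3 * n) = y ∧
    (∀ i ≤ 3 * n, ∀ j ≤ 3 * n, f i = f j → i = j) ∧
    (∀ k < n, c {f (3 * k), f (3 * k + 1), f (3 * k + 2), f (3 * k + 3)}) ∧
    ∀ i, 0 < i → i < 3 * n → f i ∈ S

/-- `v` runs periodically through a loose cycle with `m` edges, all of colour `c`. -/
def IsCyc (c : Finset V → Prop) (m : ℕ) (v : ℤ → V) : Prop :=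
  (∀ i j, v i = v j ↔ (3 * m : ℤ) ∣ i - j) ∧
    ∀ k : ℤ, c {v (3 * k), v (3 * k + 1), v (3 * k + 2), v (3 * k + 3)}

theorem LoosePath.mono {c : Finset V → Prop} {n : ℕ} {x y : V} {S T : Set V}
    (h : LoosePath c n x y S) (hST : S ⊆ T) : LoosePath c n x y T := by
  obtain ⟨f, h0, h1, h2, h3, h4⟩ := h
  exact ⟨f, h0, h1, h2, h3, fun i a b => hST (h4 i a b)⟩

theorem LoosePath.reverse {c : Finset V → Prop} {n : ℕ} {x y : V} {S : Set V}
    (h : LoosePath c n x y S) : LoosePath c n y x S := by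
  obtain ⟨f, h0, h1, h2, h3, h4⟩ := h
  refine ⟨fun i => f (3 * n - i), by simpa using h1, by simpa using h0, ?_, ?_, ?_⟩
  · intro i hi j hj hij
    have := h2 _ (by omega) _ (by omega) hij
    omega
  · intro k hk
    have := h3 (n - 1 - k) (by omega)
    have e0 : 3 * n - 3 * k = 3 * (n - 1 - k) + 3 := by omega
    have e1 : 3 * n - (3 * k + 1) = 3 * (n - 1 - k) + 2 := by omega
    have e2 : 3 * n - (3 * k + 2) = 3 * (n - 1 - k) + 1 := by omega
    have e3 : 3 * n - (3 * k + 3) = 3 * (n - 1 - k) := by omega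
    simp only [e0, e1, e2, e3]
    convert this using 1
    ext z
    simp only [Finset.mem_insert, Finset.mem_singleton]
    tauto
  · intro i hi hi'
    exact h4 _ (by omega) (by omega)

theorem LoosePath.trans {c : Finset V → Prop} {p q : ℕ} {x y z : V} {S T U : Set V}
    (h : LoosePath c p x z S) (h' : LoosePath c q z y T) (hxy : x ≠ y) (hxT : x ∉ T)
    (hyS : y ∉ S) (hzS : z ∉ S) (hzT : z ∉ T) (hzx : z ≠ x) (hzy : z ≠ y) (hST : Disjoint S T)
    (hSU : S ⊆ U) (hTU : T ⊆ U) (hzU : z ∈ U) : LoosePath c (p + q) x y U := by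
  obtain ⟨f, f0, f1, f2, f3, f4⟩ := h
  obtain ⟨g, g0, g1, g2, g3, g4⟩ := h'
  have key : ∀ i ≤ 3 * p, ∀ j, 0 < j → j ≤ 3 * q → f i ≠ g j := by
    intro i hi j hj0 hj e
    have hp : p ≠ 0 := by
      rintro rfl
      exact hzx (by rw [← f0, ← f1])
    rcases Nat.eq_zero_or_pos i with rfl | hi0
    · rcases hj.lt_or_eq with hj | rfl
      · exact hxT (by rw [← f0, e]; exact g4 j hj0 hj)
      · exact hxy (by rw [← f0, e, g1])
    · rcases hi.lt_or_eq with hi | rfl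
      · have hS := f4 i hi0 hi
        rcases hj.lt_or_eq with hj | rfl
        · exact Set.disjoint_left.1 hST hS (e ▸ g4 j hj0 hj)
        · exact hyS (by rw [← g1, ← e]; exact hS)
      · rcases hj.lt_or_eq with hj | rfl
        · exact hzT (by rw [← f1, e]; exact g4 j hj0 hj)
        · exact hzy (by rw [← f1, e, g1])
  refine ⟨fun i => if i ≤ 3 * p then f i else g (i - 3 * p), by simpa using f0, ?_, ?_, ?_, ?_⟩
  · rcases Nat.eq_zero_or_pos q with rfl | hq
    · exact absurd (by rw [← g0, ← g1]) hzy
    · simp only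
      rw [if_neg (by omega), ← g1]
      congr 1
      omega
  · intro i hi j hj e
    simp only at e
    split_ifs at e with hi' hj' hj'
    · exact f2 i hi' j hj' e
    · exact absurd e (key i hi' _ (by omega) (by omega))
    · exact absurd e.symm (key j hj' _ (by omega) (by omega))
    · have := g2 _ (by omega) _ (by omega) e
      omega
  · intro k hk
    by_cases hkp : k < p
    · simp only
      rw [if_pos (by omega), if_pos (by omega), if_pos (by omega), if_pos (by omega)]
      exact f3 k hkp
    · have := g3 (k - p) (by omega)
      have e0 : (if 3 * k ≤ 3 * p then f (3 * k) else g (3 * k - 3 * p)) = g (3 * (k - p)) := by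
        split_ifs with h1
        · have : k = p := by omega
          subst this
          simp [f1, g0]
        · congr 1
          omega
      simp only
      rw [e0, if_neg (by omega), if_neg (by omega), if_neg (by omega)]
      convert this using 3
      · congr 1; omega
      · congr 1
        · congr 1; omega
        · congr 2; omega
  · intro i hi hi'
    simp only
    split_ifs with h1
    · rcases h1.lt_or_eq with h1 | rfl
      · exact hSU (f4 i hi h1)
      · rw [f1]; exact hzU
    · exact hTU (g4 _ (by omega) (by omega))

theorem LoosePath.exists_isCyc {c : Finset V → Prop} {p q : ℕ} {x y : V} {S T : Set V}
    (h : LoosePath c p x y S) (h' : LoosePath c q y x T) (hp : 0 < p) (hq : 0 < q)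
    (hxS : x ∉ S) (hyS : y ∉ S) (hxT : x ∉ T) (hyT : y ∉ T) (hST : Disjoint S T) :
    ∃ v, IsCyc c (p + q) v := by
  obtain ⟨f, f0, f1, f2, f3, f4⟩ := h
  obtain ⟨g, g0, g1, g2, g3, g4⟩ := h'
  have hxy : x ≠ y := by
    rintro rfl
    have := f2 0 (by omega) (3 * p) le_rfl (by rw [f0, f1])
    omega
  set F : ℕ → V := fun i => if i ≤ 3 * p then f i else g (i - 3 * p) with hF
  have key : ∀ i ≤ 3 * p, ∀ j, 0 < j → j < 3 * q → f i ≠ g j := by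
    intro i hi j hj0 hj e
    have hT := g4 j hj0 hj
    rw [← e] at hT
    rcases Nat.eq_zero_or_pos i with rfl | hi0
    · exact hxT (f0 ▸ hT)
    · rcases hi.lt_or_eq with hi | rfl
      · exact Set.disjoint_left.1 hST (f4 i hi0 hi) hT
      · exact hyT (f1 ▸ hT)
  have hinj : ∀ i < 3 * (p + q), ∀ j < 3 * (p + q), F i = F j → i = j := by
    intro i hi j hj e
    simp only [hF] at e
    split_ifs at e with hi' hj' hj'
    · exact f2 i hi' j hj' e
    · exact absurd e (key i hi' _ (by omega) (by omega))
    · exact absurd e.symm (key j hj' _ (by omega) (by omega))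
    · have := g2 _ (by omega) _ (by omega) e
      omega
  have hwrap : F (3 * (p + q)) = F 0 := by
    simp only [hF]
    rw [if_neg (by omega), if_pos (by omega), f0, ← g1]
    congr 1
    omega
  have hedge : ∀ k < p + q, c {F (3 * k), F (3 * k + 1), F (3 * k + 2), F (3 * k + 3)} := by
    intro k hk
    simp only [hF]
    by_cases hkp : k < p
    · rw [if_pos (by omega), if_pos (by omega), if_pos (by omega), if_pos (by omega)]
      exact f3 k hkp
    · have := g3 (k - p) (by omega)
      have e0 : (if 3 * k ≤ 3 * p then f (3 * k) else g (3 * k - 3 * p)) = g (3 * (k - p)) := by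
        split_ifs with h1
        · have : k = p := by omega
          subst this
          simp [f1, g0]
        · congr 1
          omega
      rw [e0, if_neg (by omega), if_neg (by omega), if_neg (by omega)]
      convert this using 3
      · congr 1; omega
      · congr 1
        · congr 1; omega
        · congr 2; omega
  have hn : (0 : ℤ) < 3 * ((p + q : ℕ) : ℤ) := by positivity
  -- Periodic extension of `F`. The last vertex of the last edge has residue `0`, which is why
  -- `hwrap` is needed.
  refine ⟨fun j => F (j % (3 * ((p + q : ℕ) : ℤ))).toNat, ?_, ?_⟩
  · intro i j
    have hi0 := Int.emod_nonneg i hn.ne'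
    have hj0 := Int.emod_nonneg j hn.ne'
    have hi1 := Int.emod_lt_of_pos i hn
    have hj1 := Int.emod_lt_of_pos j hn
    constructor
    · intro e
      have := hinj _ (by omega) _ (by omega) e
      have : i % (3 * ((p + q : ℕ) : ℤ)) = j % (3 * ((p + q : ℕ) : ℤ)) := by omega
      exact Int.ModEq.dvd (Eq.symm this)
    · intro e
      have : i % (3 * ((p + q : ℕ) : ℤ)) = j % (3 * ((p + q : ℕ) : ℤ)) :=
        Eq.symm ((Int.modEq_iff_dvd).2 e)
      simp only [this]
  · intro k
    have hq : (0 : ℤ) < ((p + q : ℕ) : ℤ) := by omega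
    obtain ⟨r, hr⟩ : ∃ r : ℕ, (r : ℤ) = k % ((p + q : ℕ) : ℤ) :=
      ⟨_, Int.toNat_of_nonneg (Int.emod_nonneg k hq.ne')⟩
    have hr1 : (r : ℤ) < ((p + q : ℕ) : ℤ) := hr ▸ Int.emod_lt_of_pos k hq
    have hk := Int.emod_add_mul_ediv k ((p + q : ℕ) : ℤ)
    rw [← hr] at hk
    have hmod : ∀ s : ℕ, s < 3 →
        ((3 * k + s) % (3 * ((p + q : ℕ) : ℤ))).toNat = 3 * r + s := by
      intro s hs
      have : (3 * k + s) % (3 * ((p + q : ℕ) : ℤ)) = 3 * r + s := by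
        rw [show 3 * k + (s : ℤ) = (3 * r + s) + (3 * ((p + q : ℕ) : ℤ)) *
          (k / ((p + q : ℕ) : ℤ)) by
            linear_combination (-3) * hk]
        rw [Int.add_mul_emod_self_left]
        exact Int.emod_eq_of_lt (by omega) (by omega)
      rw [this]
      omega
    have h0 := hmod 0 (by omega)
    have h1 := hmod 1 (by omega)
    have h2 := hmod 2 (by omega)
    have h3 : F ((3 * k + 3) % (3 * ((p + q : ℕ) : ℤ))).toNat = F (3 * r + 3) := by
      by_cases hlast : r + 1 < p + q
      · congr 1
        have : (3 * k + 3) % (3 * ((p + q : ℕ) : ℤ)) = 3 * r + 3 := by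
          rw [show 3 * k + 3 = (3 * r + 3) + (3 * ((p + q : ℕ) : ℤ)) *
            (k / ((p + q : ℕ) : ℤ)) by
            linear_combination (-3) * hk]
          rw [Int.add_mul_emod_self_left]
          exact Int.emod_eq_of_lt (by omega) (by omega)
        rw [this]
        omega
      · have hr2 : r + 1 = p + q := by omega
        have : (3 * k + 3) % (3 * ((p + q : ℕ) : ℤ)) = 0 := by
          apply Int.emod_eq_zero_of_dvd
          refine ⟨k / ((p + q : ℕ) : ℤ) + 1, ?_⟩
          have : (r : ℤ) + 1 = ((p + q : ℕ) : ℤ) := by exact_mod_cast hr2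
          linear_combination (-3) * hk + 3 * this
        rw [this, show 3 * r + 3 = 3 * (p + q) by omega, hwrap]
        rfl
    simp only [Nat.cast_zero, add_zero, Nat.cast_one, Nat.cast_ofNat] at h0 h1 h2
    simp only [h0, h1, h2, h3]
    exact hedge r (by omega)

theorem IsCyc.shift {c : Finset V → Prop} {m : ℕ} {v : ℤ → V} (h : IsCyc c m v) (s : ℤ) :
    IsCyc c m (fun j => v (j + 3 * s)) := by
  refine ⟨fun i j => ?_, fun k => ?_⟩
  · rw [h.1]
    congr! 1
    ring
  · convert h.2 (k + s) using 4 <;> ring_nf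

theorem IsCyc.reverse {c : Finset V → Prop} {m : ℕ} {v : ℤ → V} (h : IsCyc c m v) (s : ℤ) :
    IsCyc c m (fun j => v (3 * s - j)) := by
  refine ⟨fun i j => ?_, fun k => ?_⟩
  · rw [h.1, ← dvd_neg]
    congr! 1
    ring
  · have := h.2 (s - k - 1)
    convert this using 1
    simp only
    rw [show 3 * s - 3 * k = 3 * (s - k - 1) + 3 by ring,
      show 3 * s - (3 * k + 1) = 3 * (s - k - 1) + 2 by ring,
      show 3 * s - (3 * k + 2) = 3 * (s - k - 1) + 1 by ring,
      show 3 * s - (3 * k + 3) = 3 * (s - k - 1) by ring]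
    ext z
    simp only [Finset.mem_insert, Finset.mem_singleton]
    tauto

theorem LoosePath.two {c : Finset V → Prop} {x y p q z r s : V} {S : Set V}
    (h1 : c {x, p, q, z}) (h2 : c {z, r, s, y}) (hn : [x, p, q, z, r, s, y].Nodup)
    (hS : ∀ t ∈ [p, q, z, r, s], t ∈ S) : LoosePath c 2 x y S := by
  refine ⟨fun i => [x, p, q, z, r, s, y].getD i x, rfl, rfl, ?_, ?_, ?_⟩
  · intro i hi j hj e
    simp only at e
    rw [List.getD_eq_getElem _ _ (by simp; omega), List.getD_eq_getElem _ _ (by simp; omega)] at e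
    exact (hn.getElem_inj_iff).1 e
  · intro k hk
    interval_cases k
    · exact h1
    · exact h2
  · intro i h0 hi
    interval_cases i <;> exact hS _ (by simp)

theorem LoosePath.three {c : Finset V → Prop} {x y p q z r s w t u : V} {S : Set V}
    (h1 : c {x, p, q, z}) (h2 : c {z, r, s, w}) (h3 : c {w, t, u, y})
    (hn : [x, p, q, z, r, s, w, t, u, y].Nodup)
    (hS : ∀ a ∈ [p, q, z, r, s, w, t, u], a ∈ S) : LoosePath c 3 x y S := by
  refine ⟨fun i => [x, p, q, z, r, s, w, t, u, y].getD i x, rfl, rfl, ?_, ?_, ?_⟩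
  · intro i hi j hj e
    simp only at e
    rw [List.getD_eq_getElem _ _ (by simp; omega), List.getD_eq_getElem _ _ (by simp; omega)] at e
    exact (hn.getElem_inj_iff).1 e
  · intro k hk
    interval_cases k
    · exact h1
    · exact h2
    · exact h3
  · intro i h0 hi
    interval_cases i <;> exact hS _ (by simp)

theorem IsCyc.inj {c : Finset V → Prop} {m : ℕ} {v : ℤ → V} (h : IsCyc c m v) {i j : ℤ}
    (hij : v i = v j) (h1 : i - j < 3 * m) (h2 : j - i < 3 * m) : i = j := by
  obtain ⟨k, hk⟩ := (h.1 i j).1 hij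
  have hk1 : k < 1 := by
    by_contra! hc
    nlinarith
  have hk2 : -1 < k := by
    by_contra! hc
    nlinarith
  have : k = 0 := by omega
  subst this
  simp at hk
  omega

/-- The first three vertices of the initial edge are interchangeable within the arc: swapping `v (3
* s)` with `v (3 * s + i)` leaves that edge unchanged as a set and moves the starting point. The old
joint becomes an inner vertex, hence the set allows every index except `3 * s + i`. -/
theorem IsCyc.arc {c : Finset V → Prop} {m : ℕ} {v : ℤ → V} (h : IsCyc c m v) (s : ℤ) {k i : ℕ}
    (hk : 0 < k) (hkm : k < m) (hi : i < 3) :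
    LoosePath c k (v (3 * s + i)) (v (3 * s + 3 * k))
      {z | ∃ j, 3 * s ≤ j ∧ j < 3 * s + 3 * k ∧ j ≠ 3 * s + i ∧ z = v j} := by
  have hsw : ∀ n, Equiv.swap 0 i n = if n = 0 then i else if n = i then 0 else n := fun n => by
    rw [Equiv.swap_apply_def]
  refine ⟨fun n => v (3 * s + (Equiv.swap 0 i n : ℕ)), by simp, ?_, ?_, ?_, ?_⟩
  · simp only [hsw]
    rw [if_neg (by omega), if_neg (by omega)]
    push_cast
    rfl
  · intro a ha b hb e
    have := h.inj e (by simp only [hsw]; split_ifs <;> omega) (by simp only [hsw]; split_ifs <;> omega)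
    exact (Equiv.swap 0 i).injective (by omega)
  · intro a ha
    have := h.2 (s + a)
    rcases Nat.eq_zero_or_pos a with rfl | ha0
    · convert this using 1
      simp only [hsw]
      ext z
      interval_cases i <;> simp <;> tauto
    · convert this using 1
      simp only [hsw]
      rw [if_neg (by omega), if_neg (by omega), if_neg (by omega), if_neg (by omega),
        if_neg (by omega), if_neg (by omega), if_neg (by omega), if_neg (by omega)]
      push_cast
      simp only [mul_add, add_assoc]
  · intro a ha0 ha
    refine ⟨_, ?_, ?_, ?_, rfl⟩ <;> simp only [hsw] <;> split_ifs <;> omega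

/-- In a longest loose cycle no `l` consecutive edges can be rerouted through `l + 1` edges. The
new path may end at any of the first three vertices of the edge that follows. -/
theorem IsCyc.not_loosePath {c : Finset V → Prop} {m : ℕ} {v : ℤ → V} (h : IsCyc c m v)
    (hno : ¬ ∃ v, IsCyc c (m + 1) v) {l i : ℕ} (hl : 0 < l) (hlm : l < m) (hi : i < 3) :
    ¬ LoosePath c (l + 1) (v 0) (v (3 * l + i))
      ({z | ∃ j, 0 < j ∧ j < 3 * (l : ℤ) ∧ z = v j} ∪ (Set.range v)ᶜ) := by
  intro hP
  apply hno
  have hA := h.arc l (k := m - l) (by omega) (by omega) hi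
  have hend : v (3 * (l : ℤ) + 3 * ((m - l : ℕ) : ℤ)) = v 0 := by
    rw [h.1]
    exact ⟨1, by push_cast [hlm.le]; ring⟩
  rw [hend] at hA
  have := hP.exists_isCyc hA (by omega) (by omega) ?_ ?_ ?_ ?_ ?_
  · rwa [show l + 1 + (m - l) = m + 1 by omega] at this
  · rintro (⟨j, h1, h2, e⟩ | h1)
    · have := h.inj e (by omega) (by omega)
      omega
    · exact h1 ⟨_, rfl⟩
  · rintro (⟨j, h1, h2, e⟩ | h1)
    · have := h.inj e (by omega) (by omega)
      omega
    · exact h1 ⟨_, rfl⟩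
  · rintro ⟨j, h1, h2, h3, e⟩
    have := h.inj e (by omega) (by omega)
    omega
  · rintro ⟨j, h1, h2, h3, e⟩
    have := h.inj e (by omega) (by omega)
    omega
  · rw [Set.disjoint_left]
    rintro z (⟨j, h1, h2, rfl⟩ | h1) ⟨j', h1', h2', h3', e⟩
    · have := h.inj e (by omega) (by omega)
      omega
    · exact h1 ⟨j', e.symm⟩

/-! ### Blue links over two consecutive red edges -/

/-- The two red edges serve as the first and last edge of a red path from `a` to `t`. Any edge
joining `r` or `s` to `p` or `q` by way of `u` and an unused vertex of `W` would be its middle edge,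
so it must be blue. Two such edges meeting in `u` form the link. -/
theorem loosePath_of_crossing {c : Finset V → Prop} {a p q r s u t w x : V} {W : Set V}
    (hnd : [a, p, q, r, s, u].Nodup) (hW : ∀ z ∈ W, z ∉ [a, p, q, r, s, u])
    (ht : t ∉ [a, p, q, r, s, u]) (htW : t ∉ W)
    (hno : ¬ LoosePath c 3 a t ({z | z ∈ [p, q, r, s, u]} ∪ W)) (hw : w ∈ W) (hx : x ∈ W)
    (hxw : x ≠ w) (h1 : c {t, p, q, w}) (h2 : c {a, r, s, x}) {y y' : V} (hy : y ∈ W)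
    (hy' : y' ∈ W) (hyy : y ≠ y') (hyw : y ≠ w) (hyx : y ≠ x) (hyw' : y' ≠ w) (hyx' : y' ≠ x) :
    LoosePath (fun e => ¬ c e) 2 y y' {z | z ∈ [p, q, r, s, u]} := by
  have hWw := hW w hw
  have hWx := hW x hx
  have hWy := hW y hy
  have hWy' := hW y' hy'
  have htw : t ≠ w := fun h => htW (h ▸ hw)
  have htx : t ≠ x := fun h => htW (h ▸ hx)
  have hty : t ≠ y := fun h => htW (h ▸ hy)
  have hty' : t ≠ y' := fun h => htW (h ▸ hy')
  simp only [List.mem_cons, List.not_mem_nil, or_false, not_or, List.nodup_cons,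
    List.nodup_nil, not_false_eq_true, and_true] at hnd hWw hWx hWy hWy' ht
  refine LoosePath.two (p := r) (q := p) (z := u) (r := s) (s := q) (fun h => hno ?_)
    (fun h => hno ?_) ?_ ?_
  · refine LoosePath.three (p := s) (q := x) (z := r) (r := u) (s := y) (w := p) (t := q) (u := w)
      ?_ ?_ ?_ ?_ ?_
    · simpa only [← insert_empty_eq, Finset.insert_comm] using h2
    · simpa only [← insert_empty_eq, Finset.insert_comm] using h
    · simpa only [← insert_empty_eq, Finset.insert_comm] using h1
    · simp; grind
    · simp [hw, hx, hy]
  · refine LoosePath.three (p := r) (q := x) (z := s) (r := u) (s := y') (w := q) (t := p) (u := w)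
      ?_ ?_ ?_ ?_ ?_
    · simpa only [← insert_empty_eq, Finset.insert_comm] using h2
    · simpa only [← insert_empty_eq, Finset.insert_comm] using h
    · simpa only [← insert_empty_eq, Finset.insert_comm] using h1
    · simp; grind
    · simp [hw, hx, hy']
  · simp; grind
  · simp

/-- In the application `a, …, f` are six consecutive cycle vertices and `C` consists of the next
three. The spared vertex `z` is required among `a, b, c` because the preceding block can borrow only
its own next three vertices; `B` collects the few vertices of `W` at which the link may fail. -/
theorem exists_block {R : Finset V → Prop} {a b c d e f : V} {C W : Set V}
    (hnd : [a, b, c, d, e, f].Nodup) (hW : ∀ z ∈ W, z ∉ [a, b, c, d, e, f])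
    (hC : ∀ z ∈ C, z ∉ [a, b, c, d, e, f]) (hCW : ∀ z ∈ C, z ∉ W)
    (hno : ∀ t ∈ C, ¬ LoosePath R 3 a t ({z | z ∈ [b, c, d, e, f]} ∪ W)) :
    ∃ z ∈ [a, b, c], ∃ B : Finset V, B.card ≤ 2 ∧ ∀ c₀ ∈ C, ∃ S : Set V,
      S ⊆ {t | t ∈ [a, b, c, d, e, f] ∧ t ≠ z ∨ t = c₀} ∧ ∀ x ∈ W, ∀ y ∈ W, x ∉ B → y ∉ B →
        x ≠ y → LoosePath (fun e => ¬ R e) 2 x y S := by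
  by_cases hcr : ∃ p q r s u, [p, q, r, s, u].Perm [b, c, d, e, f] ∧ ∃ t ∈ C, ∃ w ∈ W, ∃ x ∈ W,
      x ≠ w ∧ R {t, p, q, w} ∧ R {a, r, s, x}
  · obtain ⟨p, q, r, s, u, hp, t, ht, w, hw, x, hx, hxw, h1, h2⟩ := hcr
    have hmem : ∀ z, z ∈ [a, p, q, r, s, u] ↔ z ∈ [a, b, c, d, e, f] := fun z =>
      (hp.cons a).mem_iff
    refine ⟨a, by simp, {w, x}, Finset.card_le_two, fun c₀ _ =>
      ⟨{z | z ∈ [p, q, r, s, u]}, ?_, ?_⟩⟩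
    · intro z hz
      refine Or.inl ⟨(hmem z).1 (List.mem_cons_of_mem _ hz), ?_⟩
      rintro rfl
      exact (List.nodup_cons.1 hnd).1 (hp.mem_iff.1 hz)
    · intro y hy y' hy' hyB hyB' hyy
      simp only [Finset.mem_insert, Finset.mem_singleton, not_or] at hyB hyB'
      refine loosePath_of_crossing ((hp.cons a).nodup_iff.2 hnd) (fun z hz h => hW z hz
        ((hmem z).1 h)) (fun h => hC t ht ((hmem t).1 h)) (hCW t ht) ?_ hw hx hxw h1 h2 hy hy' hyy
        hyB.1 hyB.2 hyB'.1 hyB'.2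
      convert hno t ht using 3
      ext z
      exact hp.mem_iff
  push Not at hcr
  -- From here on there is no crossing. A pair outside `F` is blue with every vertex of `C` and
  -- every vertex of `W`; a pair in `F` makes every disjoint pair blue with `a` and all but one
  -- vertex of `W`.
  set F : V → V → Prop := fun p q => ∃ t ∈ C, ∃ w ∈ W, R {t, p, q, w} with hF
  -- Two disjoint pairs outside `F` are linked through the borrowed vertex `c₀`, sparing `a`.
  have hA : ∀ p q p' q', [a, p, q, p', q'].Nodup → (∀ z ∈ [p, q, p', q'], z ∈ [b, c, d, e, f]) →
      ¬ F p q → ¬ F p' q' → ∀ c₀ ∈ C, ∃ S : Set V,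
      S ⊆ {t | t ∈ [a, b, c, d, e, f] ∧ t ≠ a ∨ t = c₀} ∧ ∀ x ∈ W, ∀ y ∈ W, x ∉ (∅ : Finset V) →
        y ∉ (∅ : Finset V) → x ≠ y → LoosePath (fun e => ¬ R e) 2 x y S := by
    intro p q p' q' hn hm h1 h2 c₀ hc
    refine ⟨{z | z ∈ [p, q, c₀, p', q']}, ?_, fun x hx y hy _ _ hxy => ?_⟩
    · intro z hz
      simp only [Set.mem_ofPred_eq, List.mem_cons, List.not_mem_nil, or_false, List.nodup_cons,
        forall_eq_or_imp, forall_eq, not_or] at hz hm hn ⊢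
      clear hF hno hW hC hCW hcr h1 h2
      grind
    · have h3 : c₀ ∉ [p, q, p', q'] := fun h => hC c₀ hc (List.mem_cons_of_mem _ (hm _ h))
      have h4 := hCW c₀ hc
      have h5 : x ∉ [p, q, p', q'] := fun h => hW x hx (List.mem_cons_of_mem _ (hm _ h))
      have h6 : y ∉ [p, q, p', q'] := fun h => hW y hy (List.mem_cons_of_mem _ (hm _ h))
      have h7 : c₀ ≠ x := fun h => h4 (h ▸ hx)
      have h8 : c₀ ≠ y := fun h => h4 (h ▸ hy)
      refine LoosePath.two (p := p) (q := q) (z := c₀) (r := p') (s := q')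
        (fun h => h1 ⟨c₀, hc, x, hx, ?_⟩) (fun h => h2 ⟨c₀, hc, y, hy, ?_⟩) ?_ (by simp)
      · simpa only [← insert_empty_eq, Finset.insert_comm] using h
      · simpa only [← insert_empty_eq, Finset.insert_comm] using h
      · simp only [List.mem_cons, List.not_mem_nil, or_false, not_or, List.nodup_cons,
          List.nodup_nil, not_false_eq_true, and_true] at hn h3 h5 h6 ⊢
        clear hF hno hW hC hCW hcr h1 h2
        grind
  -- Two disjoint pairs that are blue with `a` are linked through `a` itself, sparing the fifth
  -- vertex `z`.
  have hB : ∀ p q r s z w₁ w₂, [a, p, q, r, s].Nodup →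
      (∀ z' ∈ [p, q, r, s], z' ∈ [b, c, d, e, f] ∧ z' ≠ z) → z ≠ a →
      (∀ x ∈ W, x ≠ w₁ → ¬ R {a, p, q, x}) → (∀ x ∈ W, x ≠ w₂ → ¬ R {a, r, s, x}) →
      ∀ c₀ ∈ C, ∃ S : Set V,
      S ⊆ {t | t ∈ [a, b, c, d, e, f] ∧ t ≠ z ∨ t = c₀} ∧ ∀ x ∈ W, ∀ y ∈ W,
        x ∉ ({w₁, w₂} : Finset V) → y ∉ ({w₁, w₂} : Finset V) → x ≠ y →
        LoosePath (fun e => ¬ R e) 2 x y S := by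
    intro p q r s z w₁ w₂ hn hm hz h1 h2 c₀ hc
    refine ⟨{z | z ∈ [p, q, a, r, s]}, ?_, fun x hx y hy hxB hyB hxy => ?_⟩
    · intro z' hz'
      simp only [Set.mem_ofPred_eq, List.mem_cons, List.not_mem_nil, or_false, List.nodup_cons,
        forall_eq_or_imp, forall_eq, not_or] at hz' hm hn ⊢
      clear hF hno hW hC hCW hcr h1 h2
      grind
    · have h5 : x ∉ [p, q, r, s] := fun h => hW x hx (List.mem_cons_of_mem _ (hm _ h).1)
      have h6 : y ∉ [p, q, r, s] := fun h => hW y hy (List.mem_cons_of_mem _ (hm _ h).1)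
      have h5' := hW x hx
      have h6' := hW y hy
      simp only [Finset.mem_insert, Finset.mem_singleton, not_or] at hxB hyB
      refine LoosePath.two (p := p) (q := q) (z := a) (r := r) (s := s)
        (fun h => h1 x hx hxB.1 ?_) (fun h => h2 y hy hyB.2 ?_) ?_ (by simp)
      · simpa only [← insert_empty_eq, Finset.insert_comm] using h
      · simpa only [← insert_empty_eq, Finset.insert_comm] using h
      · simp only [List.mem_cons, List.not_mem_nil, or_false, not_or, List.nodup_cons,
          List.nodup_nil, not_false_eq_true, and_true] at hn h5 h5' h6' h6 ⊢
        clear hF hno hW hC hCW hcr h1 h2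
        grind
  have hK : ∀ p q r s u t w, [p, q, r, s, u].Perm [b, c, d, e, f] → t ∈ C → w ∈ W →
      R {t, p, q, w} → ∀ x ∈ W, x ≠ w → ¬ R {a, r, s, x} :=
    fun p q r s u t w hp ht hw h x hx hxw => hcr p q r s u hp t ht w hw x hx hxw h
  have hperm : ∀ p q r s u, (∀ z, [p, q, r, s, u].count z = [b, c, d, e, f].count z) →
    [p, q, r, s, u].Perm [b, c, d, e, f] := fun _ _ _ _ _ h => List.perm_iff_count.2 h
  clear hcr
  simp only [List.mem_cons, List.not_mem_nil, or_false, not_or, List.nodup_cons,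
    List.nodup_nil, not_false_eq_true, and_true] at hnd
  clear_value F
  -- Either two disjoint pairs among `bd`, `be`, `ce`, `cf` lie outside `F`, and `hA` applies, or
  -- two pairs in `F` have complementary pairs that suit `hB`, with `b` or `c` spared.
  by_cases hbd : F b d
  · obtain ⟨t₁, ht₁, w₁, hw₁, hr₁⟩ := hF ▸ hbd
    by_cases hbe : F b e
    · obtain ⟨t₂, ht₂, w₂, hw₂, hr₂⟩ := hF ▸ hbe
      refine ⟨b, by simp, {w₁, w₂}, Finset.card_le_two, hB c e d f b w₁ w₂ ?_ ?_ ?_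
        (hK b d c e f t₁ w₁ ?_ ht₁ hw₁ hr₁) (hK b e d f c t₂ w₂ ?_ ht₂ hw₂ hr₂)⟩
      · simp; grind
      · simp; grind
      · grind
      · apply hperm; intro z; simp only [List.count_cons, List.count_nil]; omega
      · apply hperm; intro z; simp only [List.count_cons, List.count_nil]; omega
    by_cases hcf : F c f
    · obtain ⟨t₂, ht₂, w₂, hw₂, hr₂⟩ := hF ▸ hcf
      refine ⟨b, by simp, {w₁, w₂}, Finset.card_le_two, hB c f d e b w₁ w₂ ?_ ?_ ?_
        (hK b d c f e t₁ w₁ ?_ ht₁ hw₁ hr₁) (hK c f d e b t₂ w₂ ?_ ht₂ hw₂ hr₂)⟩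
      · simp; grind
      · simp; grind
      · grind
      · apply hperm; intro z; simp only [List.count_cons, List.count_nil]; omega
      · apply hperm; intro z; simp only [List.count_cons, List.count_nil]; omega
    · exact ⟨a, by simp, ∅, by simp, hA b e c f (by simp; grind) (by simp) hbe hcf⟩
  · by_cases hce : F c e
    · obtain ⟨t₁, ht₁, w₁, hw₁, hr₁⟩ := hF ▸ hce
      by_cases hcf : F c f
      · obtain ⟨t₂, ht₂, w₂, hw₂, hr₂⟩ := hF ▸ hcf
        refine ⟨c, by simp, {w₁, w₂}, Finset.card_le_two, hB b f d e c w₁ w₂ ?_ ?_ ?_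
          (hK c e b f d t₁ w₁ ?_ ht₁ hw₁ hr₁) (hK c f d e b t₂ w₂ ?_ ht₂ hw₂ hr₂)⟩
        · simp; grind
        · simp; grind
        · grind
        · apply hperm; intro z; simp only [List.count_cons, List.count_nil]; omega
        · apply hperm; intro z; simp only [List.count_cons, List.count_nil]; omega
      · exact ⟨a, by simp, ∅, by simp, hA b d c f (by simp; grind) (by simp) hbd hcf⟩
    · exact ⟨a, by simp, ∅, by simp, hA b d c e (by simp; grind) (by simp) hbd hce⟩

/-! ### Chaining the links -/

/-- Distinct representatives `x 0, …, x r` such that `B i` contains neither `x i` nor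
`x (i + 1)`. -/
theorem exists_hubs {W : Finset V} {r : ℕ} (hr : 0 < r) (hW : r + 3 ≤ W.card) {B : ℕ → Finset V}
    (hB : ∀ i, (B i).card ≤ 2) : ∃ x : ℕ → V, (∀ i ≤ r, x i ∈ W) ∧
      (∀ i ≤ r, ∀ j ≤ r, x i = x j → i = j) ∧ ∀ i < r, x i ∉ B i ∧ x (i + 1) ∉ B i := by
  set L : ℕ → Finset V := fun i => if 0 < i then B (i - 1) else ∅ with hL
  set U : ℕ → Finset V := fun i => if i < r then B i else ∅ with hU
  have hLc : ∀ i, (L i).card ≤ 2 := fun i => by simp only [hL]; split_ifs <;> simp [hB]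
  have hUc : ∀ i, (U i).card ≤ 2 := fun i => by simp only [hU]; split_ifs <;> simp [hB]
  -- Hall's theorem: `x i` must avoid the bad sets of the links on its left (`L i`) and right (`U
  -- i`).
  have hall := (Finset.all_card_le_biUnion_card_iff_exists_injective
    (fun i : Fin (r + 1) => (W \ L i) \ U i)).1 ?_
  · obtain ⟨g, hg, hgm⟩ := hall
    simp only [Finset.mem_sdiff] at hgm
    refine ⟨fun i => g (Fin.ofNat (r + 1) i), fun i hi => (hgm _).1.1, fun i hi j hj e => ?_,
      fun i hi => ⟨?_, ?_⟩⟩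
    · have := congrArg Fin.val (hg e)
      simpa [Nat.mod_eq_of_lt (Nat.lt_succ_of_le hi), Nat.mod_eq_of_lt (Nat.lt_succ_of_le hj)]
        using this
    · have := (hgm (Fin.ofNat (r + 1) i)).2
      simpa [hU, Nat.mod_eq_of_lt (show i < r + 1 by omega), hi] using this
    · have := (hgm (Fin.ofNat (r + 1) (i + 1))).1.2
      simpa [hL, Nat.mod_eq_of_lt (show i + 1 < r + 1 by omega)] using this
  · intro s
    have hone : ∀ i ∈ s, ((W \ L i) \ U i).card ≤
        (s.biUnion fun i : Fin (r + 1) => (W \ L i) \ U i).card := fun i hi =>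
      Finset.card_le_card (Finset.subset_biUnion_of_mem (fun i : Fin (r + 1) => (W \ L i) \ U i) hi)
    have hge : ∀ i, W.card - (L i).card - (U i).card ≤ ((W \ L i) \ U i).card := fun i => by
      have h1 := Finset.le_card_sdiff (L i) W
      have h2 := Finset.le_card_sdiff (U i) (W \ L i)
      omega
    have hs : s.card ≤ r + 1 := by simpa using Finset.card_le_univ s
    -- An end index has only one neighbouring link, so at least `W.card - 2 ≥ r + 1` candidates
    -- remain, enough for any `s`. Without end indices `s` has at most `r - 1` elements, and `W.card
    -- - 4` candidates suffice.
    by_cases hend : ∃ i ∈ s, (i : ℕ) = 0 ∨ (i : ℕ) = r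
    · obtain ⟨i, hi, hi'⟩ := hend
      have h1 := hone i hi
      have h2 := hge i
      have h3 := hLc i
      have h4 := hUc i
      have h5 : (L i).card = 0 ∨ (U i).card = 0 := by
        rcases hi' with h | h
        · left; simp [hL, h]
        · right; simp [hU, h]
      omega
    · push Not at hend
      rcases s.eq_empty_or_nonempty with rfl | ⟨i, hi⟩
      · simp
      have hcard : s.card ≤ r - 1 := by
        have h1 : s ⊆ Finset.univ \ {0, Fin.last r} := by
          intro j hj
          have := hend j hj
          simp only [Finset.mem_sdiff, Finset.mem_univ, true_and, Finset.mem_insert,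
            Finset.mem_singleton, Fin.ext_iff, Fin.val_zero, Fin.val_last]
          omega
        have h2 := Finset.card_le_card h1
        rw [Finset.card_sdiff_of_subset (Finset.subset_univ _), Finset.card_pair (by
          simp [Fin.ext_iff]; omega)] at h2
        simpa using h2
      have h1 := hone i hi
      have h2 := hge i
      have h3 := hLc i
      have h4 := hUc i
      omega

theorem LoosePath.chain {c : Finset V → Prop} {x : ℕ → V} {S : ℕ → Set V} {r : ℕ} (hr : 1 ≤ r)
    (hx : ∀ i ≤ r, ∀ j ≤ r, x i = x j → i = j)
    (hlink : ∀ i < r, LoosePath c 2 (x i) (x (i + 1)) (S i))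
    (hS : ∀ i < r, ∀ j < r, i < j → Disjoint (S i) (S j))
    (hxS : ∀ i < r, ∀ j ≤ r, x j ∉ S i) :
    LoosePath c (2 * r) (x 0) (x r) {z | (∃ i < r, z ∈ S i) ∨ ∃ i, 0 < i ∧ i < r ∧ z = x i} := by
  induction r, hr using Nat.le_induction with
  | base => exact (hlink 0 (by omega)).mono fun z hz => Or.inl ⟨0, by omega, hz⟩
  | succ r hr ih =>
    have h1 := ih (fun i hi j hj => hx i (by omega) j (by omega)) (fun i hi => hlink i (by omega))
      (fun i hi j hj => hS i (by omega) j (by omega)) (fun i hi j hj => hxS i (by omega) j (by omega))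
    refine h1.trans (hlink r (by omega)) ?_ (hxS r (by omega) 0 (by omega)) ?_ ?_
      (hxS r (by omega) r (by omega)) ?_ ?_ ?_ ?_ ?_ ?_
    · exact fun e => by have := hx _ (by omega) _ (by omega) e; omega
    · rintro (⟨i, hi, h⟩ | ⟨i, hi0, hi, e⟩)
      · exact hxS i (by omega) _ (by omega) h
      · have := hx _ (by omega) _ (by omega) e; omega
    · rintro (⟨i, hi, h⟩ | ⟨i, hi0, hi, e⟩)
      · exact hxS i (by omega) _ (by omega) h
      · have := hx _ (by omega) _ (by omega) e; omega
    · exact fun e => by have := hx _ (by omega) _ (by omega) e; omega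
    · exact fun e => by have := hx _ (by omega) _ (by omega) e; omega
    · rw [Set.disjoint_left]
      rintro z (⟨i, hi, h⟩ | ⟨i, hi0, hi, rfl⟩)
      · exact Set.disjoint_left.1 (hS i (by omega) r (by omega) hi) h
      · exact hxS _ (by omega) _ (by omega)
    · rintro z (⟨i, hi, h⟩ | ⟨i, hi0, hi, rfl⟩)
      · exact Or.inl ⟨i, by omega, h⟩
      · exact Or.inr ⟨i, hi0, by omega, rfl⟩
    · exact fun z hz => Or.inl ⟨r, by omega, hz⟩
    · exact Or.inr ⟨r, by omega, by omega, rfl⟩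

theorem IsCyc.exists_block {R : Finset V → Prop} {m : ℕ} {v : ℤ → V} (h : IsCyc R m v)
    (hno : ¬ ∃ v, IsCyc R (m + 1) v) (hm : 2 < m) (s : ℤ) :
    ∃ k : ℕ, k < 3 ∧ ∃ B : Finset V, B.card ≤ 2 ∧ ∀ i : ℕ, i < 3 → ∃ S : Set V,
      (∀ z ∈ S, ∃ j : ℤ, (0 ≤ j ∧ j < 6 ∧ j ≠ k ∨ j = 6 + i) ∧ z = v (3 * s + j)) ∧
      ∀ x ∉ Set.range v, ∀ y ∉ Set.range v, x ∉ B → y ∉ B → x ≠ y →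
        LoosePath (fun e => ¬ R e) 2 x y S := by
  have hs := h.shift s
  have hne : ∀ i j : ℤ, 0 ≤ i → i < 9 → 0 ≤ j → j < 9 → v (i + 3 * s) = v (j + 3 * s) → i = j :=
    fun i j _ _ _ _ e => hs.inj e (by omega) (by omega)
  have hblock := LooseRamsey.exists_block (R := R) (a := v (0 + 3 * s))
    (b := v (1 + 3 * s)) (c := v (2 + 3 * s)) (d := v (3 + 3 * s)) (e := v (4 + 3 * s))
    (f := v (5 + 3 * s)) (W := (Set.range v)ᶜ)
    (C := {z | ∃ i : ℕ, i < 3 ∧ z = v (6 + i + 3 * s)}) ?_ ?_ ?_ ?_ ?_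
  · obtain ⟨z, hz, B, hB, hS⟩ := hblock
    have hk : ∃ k : ℕ, k < 3 ∧ z = v (k + 3 * s) := by
      simp only [List.mem_cons, List.not_mem_nil, or_false] at hz
      rcases hz with rfl | rfl | rfl
      · exact ⟨0, by omega, by simp⟩
      · exact ⟨1, by omega, by simp⟩
      · exact ⟨2, by omega, by simp⟩
    obtain ⟨k, hk, rfl⟩ := hk
    refine ⟨k, hk, B, hB, fun i hi => ?_⟩
    obtain ⟨S, h1, h2⟩ := hS _ ⟨i, hi, rfl⟩
    refine ⟨S, fun z hz => ?_, h2⟩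
    have h6 : ∀ n : ℤ, 0 ≤ n → n < 6 → v (n + 3 * s) ≠ v (k + 3 * s) →
        ∃ j : ℤ, (0 ≤ j ∧ j < 6 ∧ j ≠ k ∨ j = 6 + i) ∧ v (n + 3 * s) = v (3 * s + j) := by
      intro n hn hn' hne
      exact ⟨n, Or.inl ⟨hn, hn', fun h => hne (h ▸ rfl)⟩, by rw [add_comm]⟩
    rcases h1 hz with ⟨h3, h4⟩ | rfl
    · simp only [List.mem_cons, List.not_mem_nil, or_false] at h3
      rcases h3 with rfl | rfl | rfl | rfl | rfl | rfl <;>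
        exact h6 _ (by omega) (by omega) h4
    · exact ⟨6 + i, Or.inr rfl, by rw [add_comm]⟩
  · simp only [List.mem_cons, List.not_mem_nil, or_false, not_or, List.nodup_cons,
      List.nodup_nil, not_false_eq_true, and_true]
    refine ⟨⟨?_, ?_, ?_, ?_, ?_⟩, ⟨?_, ?_, ?_, ?_⟩, ⟨?_, ?_, ?_⟩, ⟨?_, ?_⟩, ?_⟩ <;>
      exact fun e => absurd (hne _ _ (by omega) (by omega) (by omega) (by omega) e) (by omega)
  · intro z hz hz'
    simp only [List.mem_cons, List.not_mem_nil, or_false] at hz'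
    rcases hz' with rfl | rfl | rfl | rfl | rfl | rfl <;> exact hz ⟨_, rfl⟩
  · rintro z ⟨i, hi, rfl⟩ hz'
    simp only [List.mem_cons, List.not_mem_nil, or_false] at hz'
    rcases hz' with e | e | e | e | e | e <;>
    · have := hne _ _ (by omega) (by omega) (by omega) (by omega) e
      omega
  · rintro z ⟨i, hi, rfl⟩ hz'
    exact hz' ⟨_, rfl⟩
  · rintro z ⟨i, hi, rfl⟩ hP
    apply hs.not_loosePath hno (l := 2) (i := i) (by omega) hm hi
    refine LoosePath.mono hP (Set.union_subset ?_ ?_)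
    · intro z hz
      simp only [List.mem_cons, List.not_mem_nil, or_false, Set.mem_ofPred_eq] at hz
      rcases hz with rfl | rfl | rfl | rfl | rfl <;> exact Or.inl ⟨_, by omega, by simp, rfl⟩
    · rintro z hz
      refine Or.inr fun ⟨j, hj⟩ => hz ⟨_, hj⟩

/-- A long path of the second colour which saves one of the vertices `v (6 * r + i)`, `i < 3`,
and ends outside the cycle, where it leaves two further vertices unused. -/
theorem IsCyc.exists_chain {R : Finset V → Prop} {m : ℕ} {v : ℤ → V} (h : IsCyc R m v)
    (hno : ¬ ∃ v, IsCyc R (m + 1) v) {r : ℕ} (hr : 0 < r) (hrm : 2 * r + 1 ≤ m) {W : Finset V}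
    (hW : ∀ w ∈ W, w ∉ Set.range v) (hcard : r + 3 ≤ W.card) :
    ∃ x ∈ W, ∃ y ∈ W, ∃ p ∈ W, ∃ q ∈ W, [x, y, p, q].Nodup ∧ ∀ i : ℕ, i < 3 →
      LoosePath (fun e => ¬ R e) (2 * r) x y ({z | (∃ j : ℤ, 0 ≤ j ∧ j < 6 * r ∧ z = v j) ∨
        z = v (6 * r + i) ∨ z ∈ W ∧ z ∉ [x, y, p, q]}) := by
  have hb := fun i : ℕ => h.exists_block hno (by omega) (2 * i)
  choose k hk B hB S hS hP using hb
  obtain ⟨x, hxW, hx, hxB⟩ := exists_hubs hr hcard hB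
  have hximg : ((Finset.range (r + 1)).image x).card = r + 1 := by
    rw [Finset.card_image_of_injOn, Finset.card_range]
    intro i hi j hj e
    simp only [Finset.coe_range, Set.mem_Iio] at hi hj
    exact hx i (by omega) j (by omega) e
  -- The `r + 1` hubs leave at least two vertices of `W` over.
  have hrest : 1 < (W \ (Finset.range (r + 1)).image x).card := by
    have := Finset.le_card_sdiff ((Finset.range (r + 1)).image x) W
    omega
  obtain ⟨p, hp, q, hq, hpq⟩ := Finset.one_lt_card.1 hrest
  simp only [Finset.mem_sdiff, Finset.mem_image, Finset.mem_range, not_exists, not_and] at hp hq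
  have hpx : ∀ j ≤ r, x j ≠ p := fun j hj => hp.2 j (by omega)
  have hqx : ∀ j ≤ r, x j ≠ q := fun j hj => hq.2 j (by omega)
  have hx0 : x 0 ≠ x r := fun e => by
    have := hx _ (by omega) _ (by omega) e
    omega
  refine ⟨x 0, hxW _ (by omega), x r, hxW _ le_rfl, p, hp.1, q, hq.1, ?_, fun i hi => ?_⟩
  · have h1 := hpx 0 (by omega)
    have h2 := hpx r (by omega)
    have h3 := hqx 0 (by omega)
    have h4 := hqx r (by omega)
    simp [*]
  -- Block `n` spares its vertex number `κ n` and borrows the one spared by block `n + 1`. The last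
  -- block borrows `v (6 * r + i)`, so `κ r = i`.
  set κ : ℕ → ℕ := fun n => if n < r then k n else i with hκ
  have hκ3 : ∀ n, κ n < 3 := fun n => by simp only [hκ]; split_ifs; exacts [hk n, hi]
  set T : ℕ → Set V := fun n => S n (κ (n + 1)) (hκ3 _) with hT
  have hTmem : ∀ n < r, ∀ z ∈ T n, ∃ j : ℤ, (6 * n ≤ j ∧ j < 6 * n + 6 ∧ j ≠ 6 * n + κ n ∨
      j = 6 * ((n + 1 : ℕ) : ℤ) + κ (n + 1)) ∧ z = v j := by
    intro n hn z hz
    obtain ⟨j, hj, rfl⟩ := hS n _ (hκ3 _) z hz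
    refine ⟨_, ?_, rfl⟩
    have : κ n = k n := by simp [hκ, hn]
    rw [this]
    push_cast
    omega
  have hchain := LoosePath.chain (c := fun e => ¬ R e) (x := x) (S := T) hr hx ?_ ?_ ?_
  · refine hchain.mono ?_
    rintro z (⟨n, hn, hz⟩ | ⟨n, hn0, hn, rfl⟩)
    · obtain ⟨j, hj, rfl⟩ := hTmem n hn z hz
      by_cases hlt : j < 6 * r
      · exact Or.inl ⟨j, by omega, hlt, rfl⟩
      · have h1 := hκ3 (n + 1)
        have h2 : n + 1 = r := by omega
        have h3 : κ r = i := by simp [hκ]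
        rw [h2, h3] at hj
        exact Or.inr (Or.inl (congrArg v (by omega)))
    · refine Or.inr (Or.inr ⟨hxW n hn.le, ?_⟩)
      simp only [List.mem_cons, List.not_mem_nil, or_false, not_or]
      refine ⟨fun e => ?_, fun e => ?_, hpx n hn.le, hqx n hn.le⟩
      · have := hx _ (by omega) _ (by omega) e
        omega
      · have := hx _ (by omega) _ (by omega) e
        omega
  · intro n hn
    refine hP n _ (hκ3 _) _ (hW _ (hxW _ (by omega))) _ (hW _ (hxW _ (by omega)))
      (hxB n hn).1 (hxB n hn).2 fun e => ?_
    have := hx _ (by omega) _ (by omega) e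
    omega
  · intro n hn n' hn' hlt
    rw [Set.disjoint_left]
    intro z hz hz'
    obtain ⟨j, hj, rfl⟩ := hTmem n hn z hz
    obtain ⟨j', hj', e⟩ := hTmem n' hn' _ hz'
    have h1 := hκ3 (n + 1)
    have h2 := hκ3 (n' + 1)
    have := h.inj e (by omega) (by omega)
    subst this
    rcases Nat.lt_or_ge (n + 1) n' with h3 | h3
    · omega
    · have h4 : n' = n + 1 := by omega
      subst h4
      omega
  · intro n hn j hj hz
    obtain ⟨l, -, e⟩ := hTmem n hn _ hz
    exact hW _ (hxW j hj) ⟨l, e.symm⟩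

/-! ### Closing the chain: red cycles of even length -/

theorem LoosePath.three_of_middle {R : Finset V → Prop} {a g j j₁ j₂ t t₁ t₂ z z' : V} {S : Set V}
    (hn : [a, g, j, j₁, j₂, t, t₁, t₂].Nodup) (hz : z ∉ [a, g, j, j₁, j₂, t, t₁, t₂])
    (hz' : z' ∉ [a, g, j, j₁, j₂, t, t₁, t₂]) (hzz : z ≠ z') (h1 : R {a, j, j₁, j₂})
    (h2 : R {t, t₁, t₂, g}) (h3 : R {j, t, z, z'}) (hS : ∀ s ∈ [j, j₁, j₂, t, t₁, t₂, z, z'], s ∈ S) :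
    LoosePath R 3 a g S := by
  refine LoosePath.three (p := j₁) (q := j₂) (z := j) (r := z) (s := z') (w := t) (t := t₁)
      (u := t₂) ?_ ?_ ?_ ?_ ?_
  · simpa only [← insert_empty_eq, Finset.insert_comm] using h1
  · simpa only [← insert_empty_eq, Finset.insert_comm] using h3
  · simpa only [← insert_empty_eq, Finset.insert_comm] using h2
  · simp only [List.mem_cons, List.not_mem_nil, or_false, not_or, List.nodup_cons,
      List.nodup_nil, not_false_eq_true, and_true] at hn hz hz' ⊢
    grind
  · simp only [List.mem_cons, List.not_mem_nil, or_false, forall_eq_or_imp, forall_eq] at hS ⊢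
    tauto

/-- An edge joining one of `b, c, d` to one of `e, f, w` with two free outside vertices would
complete a red path from `a` to `g`, by `LoosePath.three_of_middle`. Three such edges, necessarily
blue, are strung together from `x` to `y`. -/
theorem loosePath_of_red_triple {R : Finset V → Prop} {a b c d e f g w x y p q : V} {S : Set V}
    (hn : [a, b, c, d, e, f, g, w, x, y, p, q].Nodup)
    (hS : ∀ s ∈ [b, c, d, e, f, w, x, y, p, q], s ∈ S) (hno : ¬ LoosePath R 3 a g S)
    (h1 : R {a, b, c, d}) (h2 : R {e, f, g, w}) :
    LoosePath (fun e => ¬ R e) 3 x y {z | z ∈ [b, e, p, c, f, q, d, w]} := by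
  simp only [List.mem_cons, List.not_mem_nil, or_false, not_or, List.nodup_cons,
      List.nodup_nil, not_false_eq_true, and_true, forall_eq_or_imp, forall_eq] at hn hS
  refine LoosePath.three (p := b) (q := e) (z := p) (r := c) (s := f) (w := q) (t := d)
    (u := w) (fun h => hno ?_) (fun h => hno ?_) (fun h => hno ?_) ?_ (by simp)
  · refine LoosePath.three_of_middle (j := b) (j₁ := c) (j₂ := d) (t := e) (t₁ := f) (t₂ := w)
      (z := x) (z' := p) ?_ ?_ ?_ ?_ ?_ ?_ ?_ ?_
    · simp; grind
    · simp; grind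
    · simp; grind
    · grind
    · exact h1
    · simpa only [← insert_empty_eq, Finset.insert_comm] using h2
    · simpa only [← insert_empty_eq, Finset.insert_comm] using h
    · simp [hS]
  · refine LoosePath.three_of_middle (j := c) (j₁ := b) (j₂ := d) (t := f) (t₁ := e) (t₂ := w)
      (z := p) (z' := q) ?_ ?_ ?_ ?_ ?_ ?_ ?_ ?_
    · simp; grind
    · simp; grind
    · simp; grind
    · grind
    · simpa only [← insert_empty_eq, Finset.insert_comm] using h1
    · simpa only [← insert_empty_eq, Finset.insert_comm] using h2
    · simpa only [← insert_empty_eq, Finset.insert_comm] using h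
    · simp [hS]
  · refine LoosePath.three_of_middle (j := d) (j₁ := b) (j₂ := c) (t := w) (t₁ := e) (t₂ := f)
      (z := q) (z' := y) ?_ ?_ ?_ ?_ ?_ ?_ ?_ ?_
    · simp; grind
    · simp; grind
    · simp; grind
    · grind
    · simpa only [← insert_empty_eq, Finset.insert_comm] using h1
    · simpa only [← insert_empty_eq, Finset.insert_comm] using h2
    · simpa only [← insert_empty_eq, Finset.insert_comm] using h
    · simp [hS]
  · simp; grind

/-- Only a blue middle edge from `{a, b, c}` to `{e, f, g}` is missing. The three candidates `{a, e,
p, d}`, `{d, b, f, q}`, `{q, w, c, g}` are chosen to form a loose path from `a` to `g`, so they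
cannot all be red. -/
theorem loosePath_of_blue_triples {R : Finset V → Prop} {a b c d e f g w x y p q : V} {S : Set V}
    (hn : [a, b, c, d, e, f, g, w, x, y, p, q].Nodup)
    (hS : ∀ s ∈ [b, c, d, e, f, w, x, y, p, q], s ∈ S) (hno : ¬ LoosePath R 3 a g S)
    (h1 : ¬ R {a, b, c, x}) (h2 : ¬ R {e, f, g, y}) :
    LoosePath (fun e => ¬ R e) 3 x y {z | z ∈ [a, b, c, d, e, f, g, w, p, q]} := by
  simp only [List.mem_cons, List.not_mem_nil, or_false, not_or, List.nodup_cons,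
      List.nodup_nil, not_false_eq_true, and_true, forall_eq_or_imp, forall_eq] at hn hS
  by_cases hr1 : R {a, e, p, d}
  · by_cases hr2 : R {d, b, f, q}
    · by_cases hr3 : R {q, w, c, g}
      · exact absurd (LoosePath.three hr1 hr2 hr3 (by simp; grind) (by simp [hS])) hno
      · refine LoosePath.three (p := a) (q := b) (z := c) (r := q) (s := w) (w := g) (t := e)
          (u := f) (fun h => h1 ?_) (fun h => hr3 ?_) (fun h => h2 ?_) ?_ (by simp)
        · simpa only [← insert_empty_eq, Finset.insert_comm] using h
        · simpa only [← insert_empty_eq, Finset.insert_comm] using h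
        · simpa only [← insert_empty_eq, Finset.insert_comm] using h
        · simp; grind
    · refine LoosePath.three (p := a) (q := c) (z := b) (r := d) (s := q) (w := f) (t := e)
        (u := g) (fun h => h1 ?_) (fun h => hr2 ?_) (fun h => h2 ?_) ?_ (by simp)
      · simpa only [← insert_empty_eq, Finset.insert_comm] using h
      · simpa only [← insert_empty_eq, Finset.insert_comm] using h
      · simpa only [← insert_empty_eq, Finset.insert_comm] using h
      · simp; grind
  · refine LoosePath.three (p := b) (q := c) (z := a) (r := d) (s := p) (w := e) (t := f)
      (u := g) (fun h => h1 ?_) (fun h => hr1 ?_) (fun h => h2 ?_) ?_ (by simp)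
    · simpa only [← insert_empty_eq, Finset.insert_comm] using h
    · simpa only [← insert_empty_eq, Finset.insert_comm] using h
    · simpa only [← insert_empty_eq, Finset.insert_comm] using h
    · simp; grind

theorem IsCyc.ne {R : Finset V → Prop} {m : ℕ} {v : ℤ → V} (h : IsCyc R m v) {i j : ℤ}
    (hij : i ≠ j) (h1 : i - j < 3 * m) (h2 : j - i < 3 * m) : v i ≠ v j :=
  fun e => hij (h.inj e h1 h2)

theorem IsCyc.nodup_seven {R : Finset V → Prop} {m : ℕ} {v : ℤ → V} (h : IsCyc R m v)
    (hm : 3 ≤ m) (s : ℤ) : [v s, v (s + 1), v (s + 2), v (s + 3), v (s + 4), v (s + 5),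
      v (s + 6)].Nodup := by
  simp only [List.mem_cons, List.not_mem_nil, or_false, not_or, List.nodup_cons,
    List.nodup_nil, not_false_eq_true, and_true]
  refine ⟨⟨?_, ?_, ?_, ?_, ?_, ?_⟩, ⟨?_, ?_, ?_, ?_, ?_⟩, ⟨?_, ?_, ?_, ?_⟩, ⟨?_, ?_, ?_⟩,
    ⟨?_, ?_⟩, ?_⟩ <;> exact h.ne (by omega) (by omega) (by omega)

theorem IsCyc.not_loosePath_three {R : Finset V → Prop} {m : ℕ} {v : ℤ → V} (h : IsCyc R m v)
    (hno : ¬ ∃ v, IsCyc R (m + 1) v) (hm : 3 ≤ m) (s : ℤ) :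
    ¬ LoosePath R 3 (v (3 * s)) (v (3 * s + 6)) ({z | z ∈ [v (3 * s + 1), v (3 * s + 2),
      v (3 * s + 3), v (3 * s + 4), v (3 * s + 5)]} ∪ (Set.range v)ᶜ) := by
  intro hP
  apply (h.shift s).not_loosePath hno (l := 2) (i := 0) (by omega) (by omega) (by omega)
  rw [show (0 : ℤ) + 3 * s = 3 * s by ring,
    show (3 * ((2 : ℕ) : ℤ) + ((0 : ℕ) : ℤ)) + 3 * s = 3 * s + 6 by push_cast; ring]
  refine hP.mono (Set.union_subset ?_ ?_)
  · intro z hz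
    simp only [List.mem_cons, List.not_mem_nil, or_false, Set.mem_ofPred_eq] at hz
    rcases hz with rfl | rfl | rfl | rfl | rfl <;>
      exact Or.inl ⟨_, by omega, by omega, congrArg v (add_comm _ _)⟩
  · exact fun z hz => Or.inr fun ⟨j, hj⟩ => hz ⟨_, hj⟩

theorem LoosePath.exists_isCyc_of_disjoint {c : Finset V → Prop} {p q : ℕ} {x y : V} {S T : Set V}
    (h : LoosePath c p x y S) (h' : LoosePath c q x y T) (hp : 0 < p) (hq : 0 < q)
    (hx : x ∉ S) (hy : y ∉ S) (hT : ∀ z ∈ T, z ∉ S ∧ z ≠ x ∧ z ≠ y) : ∃ v, IsCyc c (p + q) v :=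
  h.exists_isCyc h'.reverse hp hq hx hy (fun h => (hT x h).2.1 rfl) (fun h => (hT y h).2.2 rfl)
    (Set.disjoint_left.2 fun z hz hz' => (hT z hz').1 hz)

theorem nodup_append_of_notMem {α : Type*} {L M : List α} {A : Set α} (hL : L.Nodup)
    (hM : M.Nodup) (hLA : ∀ z ∈ L, z ∈ A) (hMA : ∀ z ∈ M, z ∉ A) : (L ++ M).Nodup :=
  List.nodup_append.2 ⟨hL, hM, fun z hz z' hz' e => hMA z' hz' (e ▸ hLA z hz)⟩

/-- The chain borrows `v (6 * r)`; the closing path needs neither it nor `v (6 * r + 6) = v 0`,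
which the chain may occupy. The vertex `w` is removed from `W` before the chain is built. -/
theorem IsCyc.false_of_red_triple {R : Finset V → Prop} {r : ℕ} {v : ℤ → V} (hr : 0 < r)
    (h : IsCyc R (2 * r + 2) v) (hno : ¬ ∃ v, IsCyc R (2 * r + 3) v)
    (hno' : ¬ ∃ v, IsCyc (fun e => ¬ R e) (2 * r + 3) v) {W : Finset V}
    (hW : ∀ w ∈ W, w ∉ Set.range v) (hcard : r + 4 ≤ W.card) {w : V} (hw : w ∈ W)
    (hred : R {v (6 * r + 4), v (6 * r + 5), v (6 * r + 6), w}) : False := by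
  obtain ⟨x, hx, y, hy, p, hp, q, hq, hn, hP⟩ := h.exists_chain hno hr (by omega)
    (W := W.erase w) (fun z hz => hW z (Finset.mem_of_mem_erase hz))
    (by rw [Finset.card_erase_of_mem hw]; omega)
  rw [Finset.mem_erase] at hx hy hp hq
  have hnd := nodup_append_of_notMem (A := Set.range v) (M := [w, x, y, p, q])
    (h.nodup_seven (by omega) (6 * r)) ?_ (by simp) (by
      simp only [List.forall_mem_cons]
      exact ⟨hW _ hw, hW _ hx.2, hW _ hy.2, hW _ hp.2, hW _ hq.2, by simp⟩)
  swap
  · simp only [List.mem_cons, List.not_mem_nil, or_false, not_or, List.nodup_cons,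
      List.nodup_nil, not_false_eq_true, and_true] at hn ⊢
    grind
  have hnoP := h.not_loosePath_three hno (by omega) (2 * r)
  have hcyc := h.2 (2 * r)
  rw [show 3 * (2 * (r : ℤ)) = 6 * r by ring] at hnoP hcyc
  have hQ := loosePath_of_red_triple hnd (by
    simp only [List.forall_mem_cons]
    simp only [Set.mem_union, Set.mem_compl_iff, hW _ hw, hW _ hx.2, hW _ hy.2, hW _ hp.2,
      hW _ hq.2]
    simp) hnoP hcyc hred
  refine hno' ((hP 0 (by omega)).exists_isCyc_of_disjoint hQ (by omega) (by omega) ?_ ?_ ?_)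
  · rintro (⟨j, -, -, e⟩ | e | ⟨-, e⟩)
    · exact hW x hx.2 ⟨j, e.symm⟩
    · exact hW x hx.2 ⟨_, e.symm⟩
    · simp at e
  · rintro (⟨j, -, -, e⟩ | e | ⟨-, e⟩)
    · exact hW y hy.2 ⟨j, e.symm⟩
    · exact hW y hy.2 ⟨_, e.symm⟩
    · simp at e
  have hcycle : ∀ i : ℤ, 0 < i → i < 6 → v (6 * r + i) ∉ {z | (∃ j : ℤ, 0 ≤ j ∧ j < 6 * r ∧
      z = v j) ∨ z = v (6 * r + (0 : ℕ)) ∨ z ∈ W.erase w ∧ z ∉ [x, y, p, q]} ∧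
      v (6 * r + i) ≠ x ∧ v (6 * r + i) ≠ y := by
    refine fun i hi hi' => ⟨?_, fun e => hW x hx.2 ⟨_, e⟩, fun e => hW y hy.2 ⟨_, e⟩⟩
    rintro (⟨j, hj, hj', e⟩ | e | ⟨e, -⟩)
    · exact h.ne (by omega) (by push_cast; omega) (by push_cast; omega) e
    · exact h.ne (by push_cast; omega) (by push_cast; omega) (by push_cast; omega) e
    · exact hW _ (Finset.mem_of_mem_erase e) ⟨_, rfl⟩
  have hrest : ∀ z ∈ W, (z ∈ W.erase w → z ∈ [x, y, p, q]) → z ∉ {z | (∃ j : ℤ, 0 ≤ j ∧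
      j < 6 * r ∧ z = v j) ∨ z = v (6 * r + (0 : ℕ)) ∨ z ∈ W.erase w ∧ z ∉ [x, y, p, q]} := by
    rintro z hz hz' (⟨j, -, -, e⟩ | e | ⟨e, e'⟩)
    · exact hW z hz ⟨j, e.symm⟩
    · exact hW z hz ⟨_, e.symm⟩
    · exact e' (hz' e)
  simp only [List.mem_cons, List.not_mem_nil, or_false, not_or, List.nodup_cons,
    List.nodup_nil, not_false_eq_true, and_true] at hn
  intro z hz
  simp only [List.mem_cons, List.not_mem_nil, or_false, Set.mem_ofPred_eq] at hz
  rcases hz with rfl | rfl | rfl | rfl | rfl | rfl | rfl | rfl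
  · exact hcycle 1 (by omega) (by omega)
  · exact hcycle 4 (by omega) (by omega)
  · exact ⟨hrest _ hp.2 (by simp), by grind, by grind⟩
  · exact hcycle 2 (by omega) (by omega)
  · exact hcycle 5 (by omega) (by omega)
  · exact ⟨hrest _ hq.2 (by simp), by grind, by grind⟩
  · exact hcycle 3 (by omega) (by omega)
  · exact ⟨hrest _ hw (by simp), hx.1.symm, hy.1.symm⟩

/-- Here the links come directly from the blue triples and skip every `v (6 * n)`. Thus `v (6 * r +
6) = v 0` stays free for the closing path of `loosePath_of_blue_triples`, which may use it. -/
theorem IsCyc.false_of_blue_triples {R : Finset V → Prop} {r : ℕ} {v : ℤ → V} (hr : 0 < r)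
    (h : IsCyc R (2 * r + 2) v) (hno : ¬ ∃ v, IsCyc R (2 * r + 3) v)
    (hno' : ¬ ∃ v, IsCyc (fun e => ¬ R e) (2 * r + 3) v) {W : Finset V}
    (hW : ∀ w ∈ W, w ∉ Set.range v) (hcard : r + 4 ≤ W.card)
    (h1 : ∀ k : ℤ, ∀ w ∈ W, ¬ R {v (3 * k), v (3 * k + 1), v (3 * k + 2), w})
    (h2 : ∀ k : ℤ, ∀ w ∈ W, ¬ R {v (3 * k + 1), v (3 * k + 2), v (3 * k + 3), w}) : False := by
  obtain ⟨x, hxW, hx, -⟩ := exists_hubs hr (show r + 3 ≤ W.card by omega) (B := fun _ => ∅)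
    (by simp)
  have hximg : ((Finset.range (r + 1)).image x).card = r + 1 := by
    rw [Finset.card_image_of_injOn, Finset.card_range]
    intro i hi j hj e
    simp only [Finset.coe_range, Set.mem_Iio] at hi hj
    exact hx i (by omega) j (by omega) e
  have hrest : 2 < (W \ (Finset.range (r + 1)).image x).card := by
    have := Finset.le_card_sdiff ((Finset.range (r + 1)).image x) W
    omega
  obtain ⟨w, hw, p, hp, q, hq, hwp, hwq, hpq⟩ := Finset.two_lt_card.1 hrest
  simp only [Finset.mem_sdiff, Finset.mem_image, Finset.mem_range, not_exists, not_and] at hw hp hq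
  have hwx : ∀ j ≤ r, x j ≠ w := fun j hj => hw.2 j (by omega)
  have hpx : ∀ j ≤ r, x j ≠ p := fun j hj => hp.2 j (by omega)
  have hqx : ∀ j ≤ r, x j ≠ q := fun j hj => hq.2 j (by omega)
  have hx0 : x 0 ≠ x r := fun e => by
    have := hx _ (by omega) _ (by omega) e
    omega
  set T : ℕ → Set V := fun i => {z | ∃ j : ℤ, 0 < j ∧ j < 6 ∧ z = v (6 * i + j)} with hT
  have hchain := LoosePath.chain (c := fun e => ¬ R e) (x := x) (S := T) hr hx ?_ ?_ ?_
  · have hnd := nodup_append_of_notMem (A := Set.range v) (M := [w, x r, x 0, p, q])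
      (h.nodup_seven (by omega) (6 * r)) ?_ (by simp) (by
        simp only [List.forall_mem_cons]
        exact ⟨hW _ hw.1, hW _ (hxW _ le_rfl), hW _ (hxW _ (by omega)), hW _ hp.1, hW _ hq.1,
          by simp⟩)
    swap
    · have := hwx 0 (by omega)
      have := hpx 0 (by omega)
      have := hqx 0 (by omega)
      have := hwx r (by omega)
      have := hpx r (by omega)
      have := hqx r (by omega)
      simp only [List.mem_cons, List.not_mem_nil, or_false, not_or, List.nodup_cons,
        List.nodup_nil, not_false_eq_true, and_true]
      grind
    have hnoP := h.not_loosePath_three hno (by omega) (2 * r)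
    have hb1 := h1 (2 * r) (x r) (hxW _ le_rfl)
    have hb2 := h2 (2 * r + 1) (x 0) (hxW _ (by omega))
    rw [show 3 * (2 * (r : ℤ)) = 6 * r by ring] at hnoP hb1
    rw [show 3 * (2 * (r : ℤ) + 1) + 1 = 6 * r + 4 by ring,
      show 3 * (2 * (r : ℤ) + 1) + 2 = 6 * r + 5 by ring,
      show 3 * (2 * (r : ℤ) + 1) + 3 = 6 * r + 6 by ring] at hb2
    have hQ := loosePath_of_blue_triples hnd (by
      simp only [List.forall_mem_cons]
      simp only [Set.mem_union, Set.mem_compl_iff, hW _ hw.1, hW _ (hxW r le_rfl),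
        hW _ (hxW 0 (by omega)), hW _ hp.1, hW _ hq.1]
      simp) hnoP hb1 hb2
    refine hno' (hchain.exists_isCyc_of_disjoint hQ.reverse (by omega) (by omega) ?_ ?_ ?_)
    · rintro (⟨i, -, j, -, -, e⟩ | ⟨i, hi, hir, e⟩)
      · exact hW _ (hxW _ (by omega)) ⟨_, e.symm⟩
      · have := hx _ (by omega) _ (by omega) e
        omega
    · rintro (⟨i, -, j, -, -, e⟩ | ⟨i, hi, hir, e⟩)
      · exact hW _ (hxW _ (by omega)) ⟨_, e.symm⟩
      · have := hx _ (by omega) _ (by omega) e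
        omega
    have hcycle : ∀ i : ℤ, 0 ≤ i → i < 7 → v (6 * r + i) ∉ {z | (∃ i < r, z ∈ T i) ∨
        ∃ i, 0 < i ∧ i < r ∧ z = x i} ∧ v (6 * r + i) ≠ x 0 ∧ v (6 * r + i) ≠ x r := by
      refine fun i hi hi' => ⟨?_, fun e => hW _ (hxW 0 (by omega)) ⟨_, e⟩,
        fun e => hW _ (hxW r (by omega)) ⟨_, e⟩⟩
      rintro (⟨n, hn, j, hj, hj', e⟩ | ⟨n, hn0, hn, e⟩)
      · rcases (show i < 6 ∨ i = 6 by omega) with h6 | rfl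
        · exact h.ne (by omega) (by push_cast; omega) (by push_cast; omega) e
        · have e0 : v (6 * r + 6) = v 0 := by
            rw [h.1]
            exact ⟨1, by push_cast; ring⟩
          rw [e0] at e
          exact h.ne (by omega) (by push_cast; omega) (by push_cast; omega) e
      · exact hW _ (hxW n hn.le) ⟨_, e⟩
    have hrest : ∀ z ∈ W, (∀ j ≤ r, x j ≠ z) → z ∉ {z | (∃ i < r, z ∈ T i) ∨
        ∃ i, 0 < i ∧ i < r ∧ z = x i} ∧ z ≠ x 0 ∧ z ≠ x r := by
      refine fun z hz hz' => ⟨?_, (hz' 0 (by omega)).symm, (hz' r le_rfl).symm⟩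
      rintro (⟨i, -, j, -, -, e⟩ | ⟨i, hi, hir, e⟩)
      · exact hW _ hz ⟨_, e.symm⟩
      · exact hz' i hir.le e.symm
    intro z hz
    simp only [List.mem_cons, List.not_mem_nil, or_false, Set.mem_ofPred_eq] at hz
    rcases hz with rfl | rfl | rfl | rfl | rfl | rfl | rfl | rfl | rfl | rfl
    · simpa using hcycle 0 (by omega) (by omega)
    · exact hcycle 1 (by omega) (by omega)
    · exact hcycle 2 (by omega) (by omega)
    · exact hcycle 3 (by omega) (by omega)
    · exact hcycle 4 (by omega) (by omega)
    · exact hcycle 5 (by omega) (by omega)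
    · exact hcycle 6 (by omega) (by omega)
    · exact hrest _ hw.1 hwx
    · exact hrest _ hp.1 hpx
    · exact hrest _ hq.1 hqx
  · intro n hn
    have hnd := nodup_append_of_notMem (A := Set.range v) (M := [x n, x (n + 1)])
      (h.nodup_seven (by omega) (6 * n)) (by
        simp only [List.nodup_cons, List.mem_singleton, List.not_mem_nil, not_false_eq_true,
          List.nodup_nil, and_true]
        intro e
        have := hx _ (by omega) _ (by omega) e
        omega) (by simp) (by
        simp only [List.forall_mem_cons]
        exact ⟨hW _ (hxW _ (by omega)), hW _ (hxW _ (by omega)), by simp⟩)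
    have hb1 := h2 (2 * n) (x n) (hxW _ hn.le)
    have hb2 := h1 (2 * n + 1) (x (n + 1)) (hxW _ (by omega))
    rw [show 3 * (2 * (n : ℤ)) = 6 * n by ring] at hb1
    rw [show 3 * (2 * (n : ℤ) + 1) = 6 * n + 3 by ring, show 6 * (n : ℤ) + 3 + 1 = 6 * n + 4 by ring,
      show 6 * (n : ℤ) + 3 + 2 = 6 * n + 5 by ring] at hb2
    refine LoosePath.two (p := v (6 * n + 1)) (q := v (6 * n + 2)) (z := v (6 * n + 3))
      (r := v (6 * n + 4)) (s := v (6 * n + 5)) (fun e => hb1 ?_) (fun e => hb2 ?_) ?_ ?_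
    · simpa only [← insert_empty_eq, Finset.insert_comm] using e
    · simpa only [← insert_empty_eq, Finset.insert_comm] using e
    · simp only [List.cons_append, List.nil_append, List.mem_cons, List.not_mem_nil, or_false,
        not_or, List.nodup_cons, List.nodup_nil, not_false_eq_true, and_true] at hnd ⊢
      grind
    · simp only [List.mem_cons, List.not_mem_nil, or_false]
      rintro z (rfl | rfl | rfl | rfl | rfl) <;> exact ⟨_, by omega, by omega, rfl⟩
  · intro n hn n' hn' hlt
    rw [Set.disjoint_left]
    rintro z ⟨j, hj, hj', rfl⟩ ⟨i, hi, hi', e⟩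
    exact h.ne (by omega) (by push_cast; omega) (by push_cast; omega) e
  · rintro n hn j hj ⟨l, -, -, e⟩
    exact hW _ (hxW j hj) ⟨_, e.symm⟩

/-- A longest cycle of even length cannot miss too many vertices. -/
theorem IsCyc.false_of_even {R : Finset V → Prop} {r : ℕ} {v : ℤ → V} (hr : 0 < r)
    (h : IsCyc R (2 * r + 2) v) (hno : ¬ ∃ v, IsCyc R (2 * r + 3) v)
    (hno' : ¬ ∃ v, IsCyc (fun e => ¬ R e) (2 * r + 3) v) {W : Finset V}
    (hW : ∀ w ∈ W, w ∉ Set.range v) (hcard : r + 4 ≤ W.card) : False := by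
  refine h.false_of_blue_triples hr hno hno' hW hcard (fun k w hw hred => ?_)
    (fun k w hw hred => ?_)
  · refine (h.reverse (k + 2 * r + 2)).false_of_red_triple hr hno hno'
      (fun z hz ⟨j, hj⟩ => hW z hz ⟨_, hj⟩) hcard hw ?_
    rw [show 3 * (k + 2 * r + 2) - (6 * (r : ℤ) + 4) = 3 * k + 2 by ring,
      show 3 * (k + 2 * r + 2) - (6 * (r : ℤ) + 5) = 3 * k + 1 by ring,
      show 3 * (k + 2 * r + 2) - (6 * (r : ℤ) + 6) = 3 * k by ring]
    simpa only [← insert_empty_eq, Finset.insert_comm] using hred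
  · refine (h.shift (k - 2 * r - 1)).false_of_red_triple hr hno hno'
      (fun z hz ⟨j, hj⟩ => hW z hz ⟨_, hj⟩) hcard hw ?_
    rwa [show (6 * (r : ℤ) + 4) + 3 * (k - 2 * r - 1) = 3 * k + 1 by ring,
      show (6 * (r : ℤ) + 5) + 3 * (k - 2 * r - 1) = 3 * k + 2 by ring,
      show (6 * (r : ℤ) + 6) + 3 * (k - 2 * r - 1) = 3 * k + 3 by ring]

/-! ### Closing the chain: red cycles of odd length -/

/-- Red edges at `a` forced by the absence of a blue path with two edges through `a` and one
vertex of `P` that joins two vertices of `W`. -/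
def Forcing (R : Finset V → Prop) (a : V) (P : List V) (W : Finset V) : Prop :=
  ∀ s ∈ W, ∃ x ∈ W, ∃ y ∈ W, ∃ u ∈ W, ∃ w ∈ W, [s, x, y, u, w].Nodup ∧
    ∀ p ∈ P, ∀ p₁ q r, [p₁, q, r].Perm [s, u, w] →
      (R {a, p, x, p₁} ∨ R {a, q, r, y}) ∧ (R {a, p, y, p₁} ∨ R {a, q, r, x})

/-- By `hX`, a red edge at `d` inside `b, c` and `W` cannot meet `{b, s₁, s₂}` in exactly one vertex
if `{a, b, s₁, s₂}` is red. In each position of `s₂`, the forcing at `d` with `s = s₁` offers two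
edges of exactly this kind and makes one of them red. -/
theorem Forcing.blue {R : Finset V → Prop} {a b c d : V} {W : Finset V} (hbc : b ≠ c)
    (hb : b ∉ W) (hc : c ∉ W) (hd : Forcing R d [b, c] W)
    (hX : ∀ α β γ δ s, [α, β, s].Nodup → [γ, δ, s].Nodup →
      (∀ z ∈ [α, β, γ, δ, s], z ∈ [b, c] ∨ z ∈ W) → R {a, α, β, s} → R {d, γ, δ, s} →
      α = γ ∨ α = δ ∨ β = γ ∨ β = δ) {s₁ s₂ : V} (h₁ : s₁ ∈ W) (h₂ : s₂ ∈ W) (h₁₂ : s₁ ≠ s₂) :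
    ¬ R {a, b, s₁, s₂} := by
  intro hR
  obtain ⟨x, hx, y, hy, u, hu, w, hw, hn, hf⟩ := hd s₁ h₁
  have hne : ∀ z ∈ W, z ≠ b ∧ z ≠ c := fun z hz => ⟨fun e => hb (e ▸ hz), fun e => hc (e ▸ hz)⟩
  have n1 := hne _ h₁
  have n2 := hne _ h₂
  have n3 := hne _ hx
  have n4 := hne _ hy
  have n5 := hne _ hu
  have n6 := hne _ hw
  simp only [List.mem_cons, List.not_mem_nil, or_false, not_or, List.nodup_cons,
    List.nodup_nil, not_false_eq_true, and_true] at hn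
  by_cases hs : s₂ = y ∨ s₂ = u ∨ s₂ = w
  · rcases (hf c (by simp) s₁ u w (List.Perm.refl _)).1 with h | h
    · have := hX b s₂ c x s₁ (by simp; grind) (by simp; grind) (by simp [*])
        (by simpa only [← insert_empty_eq, Finset.insert_comm] using hR)
        (by simpa only [← insert_empty_eq, Finset.insert_comm] using h)
      grind
    · rcases hs with rfl | rfl | rfl
      · have := hX b s₁ u w s₂ (by simp; grind) (by simp; grind) (by simp [*])
          (by simpa only [← insert_empty_eq, Finset.insert_comm] using hR)
          (by simpa only [← insert_empty_eq, Finset.insert_comm] using h)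
        grind
      · have := hX b s₁ w y s₂ (by simp; grind) (by simp; grind) (by simp [*])
          (by simpa only [← insert_empty_eq, Finset.insert_comm] using hR)
          (by simpa only [← insert_empty_eq, Finset.insert_comm] using h)
        grind
      · have := hX b s₁ u y s₂ (by simp; grind) (by simp; grind) (by simp [*])
          (by simpa only [← insert_empty_eq, Finset.insert_comm] using hR)
          (by simpa only [← insert_empty_eq, Finset.insert_comm] using h)
        grind
  · have hperm : [u, s₁, w].Perm [s₁, u, w] := List.Perm.swap _ _ _
    have hlast : R {d, s₁, w, y} → False := fun h => by
      have := hX b s₂ w y s₁ (by simp; grind) (by simp; grind) (by simp [*])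
        (by simpa only [← insert_empty_eq, Finset.insert_comm] using hR)
        (by simpa only [← insert_empty_eq, Finset.insert_comm] using h)
      grind
    by_cases hsx : s₂ = x
    · subst hsx
      rcases (hf c (by simp) u s₁ w hperm).1 with h | h
      · have := hX b s₁ c u s₂ (by simp; grind) (by simp; grind) (by simp [*])
          (by simpa only [← insert_empty_eq, Finset.insert_comm] using hR)
          (by simpa only [← insert_empty_eq, Finset.insert_comm] using h)
        grind
      · exact hlast h
    · rcases (hf b (by simp) u s₁ w hperm).1 with h | h
      · have := hX s₁ s₂ u x b (by simp; grind) (by simp; grind) (by simp [*])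
          (by simpa only [← insert_empty_eq, Finset.insert_comm] using hR)
          (by simpa only [← insert_empty_eq, Finset.insert_comm] using h)
        grind
      · exact hlast h

/-- As edges `{a, b, ·, ·}` into `W` are blue, the forcing yields red `{a, s, α, β}` for all four
pairs with `α ∈ {u, w}` and `β ∈ {x, y}`. Likewise `{d, s, w', y'}` and `{d, s, u', y'}` are red. By
`hX` both `{w', y'}` and `{u', y'}` meet all four pairs, so each is `{u, w}` or `{x, y}`; sharing
`y'`, they coincide, against `u' ≠ w'`. -/
theorem Forcing.false {R : Finset V → Prop} {a b c d : V} {W : Finset V} (hbc : b ≠ c)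
    (hb : b ∉ W) (hc : c ∉ W) (hW : W.Nonempty) (ha : Forcing R a [b, c] W)
    (hd : Forcing R d [b, c] W)
    (hX : ∀ α β γ δ s, [α, β, s].Nodup → [γ, δ, s].Nodup →
      (∀ z ∈ [α, β, γ, δ, s], z ∈ [b, c] ∨ z ∈ W) → R {a, α, β, s} → R {d, γ, δ, s} →
      α = γ ∨ α = δ ∨ β = γ ∨ β = δ) : False := by
  have hX' : ∀ α β γ δ s, [α, β, s].Nodup → [γ, δ, s].Nodup →
      (∀ z ∈ [α, β, γ, δ, s], z ∈ [b, c] ∨ z ∈ W) → R {d, α, β, s} → R {a, γ, δ, s} →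
      α = γ ∨ α = δ ∨ β = γ ∨ β = δ := by
    intro α β γ δ s h1 h2 h3 h4 h5
    have := hX γ δ α β s h2 h1 (fun z hz => h3 z (by simp at hz ⊢; tauto)) h5 h4
    grind
  have hab : ∀ s₁ ∈ W, ∀ s₂ ∈ W, s₁ ≠ s₂ → ¬ R {a, b, s₁, s₂} := fun _ h₁ _ h₂ h =>
    Forcing.blue hbc hb hc hd hX h₁ h₂ h
  have hdb : ∀ s₁ ∈ W, ∀ s₂ ∈ W, s₁ ≠ s₂ → ¬ R {d, b, s₁, s₂} := fun _ h₁ _ h₂ h =>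
    Forcing.blue hbc hb hc ha hX' h₁ h₂ h
  obtain ⟨s, hs⟩ := hW
  obtain ⟨x, hx, y, hy, u, hu, w, hw, hn, hf⟩ := ha s hs
  obtain ⟨x', hx', y', hy', u', hu', w', hw', hn', hf'⟩ := hd s hs
  simp only [List.mem_cons, List.not_mem_nil, or_false, not_or, List.nodup_cons,
    List.nodup_nil, not_false_eq_true, and_true] at hn hn'
  have p1 : ∀ u w : V, [u, s, w].Perm [s, u, w] := fun u w => List.Perm.swap _ _ _
  have p2 : ∀ u w : V, [w, s, u].Perm [s, u, w] := fun u w => List.perm_append_comm (l₁ := [w])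
  have a1 := hf b (by simp) u s w (p1 u w)
  have a2 := hf b (by simp) w s u (p2 u w)
  have d1 := (hf' b (by simp) u' s w' (p1 u' w')).1.resolve_left
    (hdb _ hx' _ hu' (by grind))
  have d2 := (hf' b (by simp) w' s u' (p2 u' w')).1.resolve_left
    (hdb _ hx' _ hw' (by grind))
  have a3 := a1.1.resolve_left (hab _ hx _ hu (by grind))
  have a4 := a1.2.resolve_left (hab _ hy _ hu (by grind))
  have a5 := a2.1.resolve_left (hab _ hx _ hw (by grind))
  have a6 := a2.2.resolve_left (hab _ hy _ hw (by grind))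
  have key : ∀ α ∈ W, ∀ β ∈ W, ∀ γ ∈ W, ∀ δ ∈ W, [α, β, s].Nodup → [γ, δ, s].Nodup →
      R {a, s, α, β} → R {d, s, γ, δ} → α = γ ∨ α = δ ∨ β = γ ∨ β = δ := by
    intro α hα β hβ γ hγ δ hδ h1 h2 h3 h4
    exact hX α β γ δ s h1 h2 (by simp [*])
      (by simpa only [← insert_empty_eq, Finset.insert_comm] using h3)
      (by simpa only [← insert_empty_eq, Finset.insert_comm] using h4)
  have n1 : [w', y', s].Nodup := by simp; grind
  have n2 : [u', y', s].Nodup := by simp; grind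
  have n3 : [w, y, s].Nodup := by simp; grind
  have n4 : [w, x, s].Nodup := by simp; grind
  have n5 : [u, y, s].Nodup := by simp; grind
  have n6 : [u, x, s].Nodup := by simp; grind
  have k1 := key w hw y hy w' hw' y' hy' n3 n1 a3 d1
  have k2 := key w hw x hx w' hw' y' hy' n4 n1 a4 d1
  have k3 := key u hu y hy w' hw' y' hy' n5 n1 a5 d1
  have k4 := key u hu x hx w' hw' y' hy' n6 n1 a6 d1
  have l1 := key w hw y hy u' hu' y' hy' n3 n2 a3 d2
  have l2 := key w hw x hx u' hu' y' hy' n4 n2 a4 d2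
  have l3 := key u hu y hy u' hu' y' hy' n5 n2 a5 d2
  have l4 := key u hu x hx u' hu' y' hy' n6 n2 a6 d2
  clear hX hX' hab hdb key hf hf' a1 a2 d1 d2 a3 a4 a5 a6 p1 p2
  grind

theorem IsCyc.forcing {R : Finset V → Prop} {r : ℕ} {v : ℤ → V} (hr : 0 < r)
    (h : IsCyc R (2 * r + 1) v) (hno : ¬ ∃ v, IsCyc R (2 * r + 2) v)
    (hno' : ¬ ∃ v, IsCyc (fun e => ¬ R e) (2 * r + 2) v) {W : Finset V}
    (hW : ∀ w ∈ W, w ∉ Set.range v) (hcard : r + 4 ≤ W.card) :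
    Forcing R (v (6 * r)) [v (6 * r + 1), v (6 * r + 2)] W := by
  intro s hs
  obtain ⟨x, hx, y, hy, u, hu, w, hw, hn, hP⟩ := h.exists_chain hno hr (by omega)
    (W := W.erase s) (fun z hz => hW z (Finset.mem_of_mem_erase hz))
    (by rw [Finset.card_erase_of_mem hs]; omega)
  rw [Finset.mem_erase] at hx hy hu hw
  have hn' : [s, x, y, u, w].Nodup := by
    refine List.nodup_cons.2 ⟨?_, hn⟩
    simp only [List.mem_cons, List.not_mem_nil, or_false, not_or]
    exact ⟨hx.1.symm, hy.1.symm, hu.1.symm, hw.1.symm⟩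
  refine ⟨x, hx.2, y, hy.2, u, hu.2, w, hw.2, hn', ?_⟩
  -- The chain may borrow either of `v (6 * r + 1)`, `v (6 * r + 2)`; whichever it takes, the other
  -- is left for a closing path through `v (6 * r)`.
  have key : ∀ i k : ℕ, 0 < i → i < 3 → 0 < k → k < 3 → i ≠ k → ∀ p₁ q t,
      [p₁, q, t].Perm [s, u, w] →
      ¬ LoosePath (fun e => ¬ R e) 2 x y {z | z ∈ [v (6 * r), v (6 * r + k), p₁, q, t]} := by
    intro i k hi hi' hk hk' hik p₁ q t hp hQ
    refine hno' ((hP i hi').exists_isCyc_of_disjoint hQ (by omega) (by omega) ?_ ?_ ?_)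
    · rintro (⟨j, -, -, e⟩ | e | ⟨-, e⟩)
      · exact hW x hx.2 ⟨j, e.symm⟩
      · exact hW x hx.2 ⟨_, e.symm⟩
      · simp at e
    · rintro (⟨j, -, -, e⟩ | e | ⟨-, e⟩)
      · exact hW y hy.2 ⟨j, e.symm⟩
      · exact hW y hy.2 ⟨_, e.symm⟩
      · simp at e
    have hcycle : ∀ j : ℤ, 0 ≤ j → j < 3 → j ≠ i → v (6 * r + j) ∉ {z | (∃ j : ℤ, 0 ≤ j ∧
        j < 6 * r ∧ z = v j) ∨ z = v (6 * r + i) ∨ z ∈ W.erase s ∧ z ∉ [x, y, u, w]} ∧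
        v (6 * r + j) ≠ x ∧ v (6 * r + j) ≠ y := by
      refine fun j hj hj' hji => ⟨?_, fun e => hW x hx.2 ⟨_, e⟩, fun e => hW y hy.2 ⟨_, e⟩⟩
      rintro (⟨l, hl, hl', e⟩ | e | ⟨e, -⟩)
      · exact h.ne (by omega) (by push_cast; omega) (by push_cast; omega) e
      · exact h.ne (by omega) (by push_cast; omega) (by push_cast; omega) e
      · exact hW _ (Finset.mem_of_mem_erase e) ⟨_, rfl⟩
    have hrest : ∀ z ∈ [s, u, w], z ∉ {z | (∃ j : ℤ, 0 ≤ j ∧ j < 6 * r ∧ z = v j) ∨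
        z = v (6 * r + i) ∨ z ∈ W.erase s ∧ z ∉ [x, y, u, w]} ∧ z ≠ x ∧ z ≠ y := by
      intro z hz
      simp only [List.mem_cons, List.not_mem_nil, or_false] at hz
      have hzW : z ∈ W := by
        rcases hz with rfl | rfl | rfl
        exacts [hs, hu.2, hw.2]
      refine ⟨?_, ?_⟩
      · rintro (⟨j, -, -, e⟩ | e | ⟨e, e'⟩)
        · exact hW z hzW ⟨j, e.symm⟩
        · exact hW z hzW ⟨_, e.symm⟩
        · rw [Finset.mem_erase] at e
          simp only [List.mem_cons, List.not_mem_nil, or_false, not_or] at e'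
          tauto
      · simp only [List.mem_cons, List.not_mem_nil, or_false, not_or, List.nodup_cons,
          List.nodup_nil, not_false_eq_true, and_true] at hn'
        grind
    intro z hz
    rw [Set.mem_ofPred_eq, List.mem_cons, List.mem_cons, hp.mem_iff] at hz
    rcases hz with rfl | rfl | hz
    · simpa using hcycle 0 (by omega) (by omega) (by omega)
    · exact hcycle k (by omega) (by omega) (by omega)
    · exact hrest z hz
  have hlink : ∀ k : ℕ, 0 < k → k < 3 → ∀ x' y', [x', y'].Perm [x, y] → ∀ p₁ q t,
      [p₁, q, t].Perm [s, u, w] → ¬ R {v (6 * r), v (6 * r + k), x', p₁} →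
      ¬ R {v (6 * r), q, t, y'} →
      LoosePath (fun e => ¬ R e) 2 x' y' {z | z ∈ [v (6 * r), v (6 * r + k), p₁, q, t]} := by
    intro k hk hk' x' y' hxy p₁ q t hp h1 h2
    have hperm : [x', y', p₁, q, t].Perm [x, y, s, u, w] := hxy.append hp
    have hmem : ∀ z ∈ [x', y', p₁, q, t], z ∈ W := by
      intro z hz
      rw [hperm.mem_iff] at hz
      simp only [List.mem_cons, List.not_mem_nil, or_false] at hz
      rcases hz with rfl | rfl | rfl | rfl | rfl
      exacts [hx.2, hy.2, hs, hu.2, hw.2]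
    have hnd := nodup_append_of_notMem (A := Set.range v) (L := [v (6 * r), v (6 * r + k)])
      (M := [x', y', p₁, q, t]) (by
        have := h.ne (i := 6 * r) (j := 6 * r + k) (by omega) (by push_cast; omega)
          (by push_cast; omega)
        simpa using this) (by
        rw [hperm.nodup_iff]
        simp only [List.mem_cons, List.not_mem_nil, or_false, not_or, List.nodup_cons,
          List.nodup_nil, not_false_eq_true, and_true] at hn' ⊢
        grind) (by simp) (fun z hz => hW z (hmem z hz))
    refine LoosePath.two (p := v (6 * r + k)) (q := p₁) (z := v (6 * r)) (r := q) (s := t)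
      (fun e => h1 ?_) (fun e => h2 ?_) ?_ (by simp)
    · simpa only [← insert_empty_eq, Finset.insert_comm] using e
    · exact e
    · simp only [List.cons_append, List.nil_append, List.mem_cons, List.not_mem_nil, or_false,
        not_or, List.nodup_cons, List.nodup_nil, not_false_eq_true, and_true] at hnd ⊢
      grind
  have hmain : ∀ i k : ℕ, 0 < i → i < 3 → 0 < k → k < 3 → i ≠ k → ∀ p₁ q t,
      [p₁, q, t].Perm [s, u, w] →
      (R {v (6 * r), v (6 * r + k), x, p₁} ∨ R {v (6 * r), q, t, y}) ∧
      (R {v (6 * r), v (6 * r + k), y, p₁} ∨ R {v (6 * r), q, t, x}) := by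
    intro i k hi hi' hk hk' hik p₁ q t hp
    constructor
    · by_contra! hcon
      exact key i k hi hi' hk hk' hik p₁ q t hp
        (hlink k hk hk' x y (List.Perm.refl _) p₁ q t hp hcon.1 hcon.2)
    · by_contra! hcon
      exact key i k hi hi' hk hk' hik p₁ q t hp
        (hlink k hk hk' y x (List.Perm.swap _ _ _) p₁ q t hp hcon.1 hcon.2).reverse
  intro p hp
  simp only [List.mem_cons, List.not_mem_nil, or_false] at hp
  rcases hp with rfl | rfl
  · exact hmain 2 1 (by omega) (by omega) (by omega) (by omega) (by omega)
  · exact hmain 1 2 (by omega) (by omega) (by omega) (by omega) (by omega)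

/-- A longest cycle of odd length cannot miss too many vertices. -/
theorem IsCyc.false_of_odd {R : Finset V → Prop} {r : ℕ} {v : ℤ → V} (hr : 0 < r)
    (h : IsCyc R (2 * r + 1) v) (hno : ¬ ∃ v, IsCyc R (2 * r + 2) v)
    (hno' : ¬ ∃ v, IsCyc (fun e => ¬ R e) (2 * r + 2) v) {W : Finset V}
    (hW : ∀ w ∈ W, w ∉ Set.range v) (hcard : r + 4 ≤ W.card) : False := by
  have ha := h.forcing hr hno hno' hW hcard
  -- This reflection reverses the edge `v (6 * r), …, v (6 * r + 3)`, so both of its ends force red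
  -- edges.
  have hd := (h.reverse (4 * r + 1)).forcing hr hno hno' (W := W)
    (fun z hz ⟨j, hj⟩ => hW z hz ⟨_, hj⟩) hcard
  rw [show 3 * (4 * r + 1) - 6 * (r : ℤ) = 6 * r + 3 by ring,
    show 3 * (4 * r + 1) - (6 * (r : ℤ) + 1) = 6 * r + 2 by ring,
    show 3 * (4 * r + 1) - (6 * (r : ℤ) + 2) = 6 * r + 1 by ring] at hd
  have hd' : Forcing R (v (6 * r + 3)) [v (6 * r + 1), v (6 * r + 2)] W := by
    intro s hs
    obtain ⟨x, hx, y, hy, u, hu, w, hw, hn, hf⟩ := hd s hs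
    exact ⟨x, hx, y, hy, u, hu, w, hw, hn, fun p hp => hf p (by simp at hp ⊢; tauto)⟩
  have hnd := h.nodup_seven (by omega) (6 * r)
  simp only [List.mem_cons, List.not_mem_nil, or_false, not_or, List.nodup_cons,
    List.nodup_nil, not_false_eq_true, and_true] at hnd
  refine Forcing.false (by tauto) (fun e => hW _ e ⟨_, rfl⟩) (fun e => hW _ e ⟨_, rfl⟩)
    (Finset.card_pos.1 (by omega)) ha hd' ?_
  -- Two such red edges with disjoint pairs would replace this one edge of the cycle by a red path
  -- of two edges, giving a longer red cycle.
  intro α β γ δ s h1 h2 h3 h4 h5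
  by_contra! hcon
  apply (h.shift (2 * r)).not_loosePath hno (l := 1) (i := 0) (by omega) (by omega) (by omega)
  rw [show (0 : ℤ) + 3 * (2 * r) = 6 * r by ring,
    show (3 * ((1 : ℕ) : ℤ) + ((0 : ℕ) : ℤ)) + 3 * (2 * r) = 6 * r + 3 by push_cast; ring]
  have hne : ∀ z ∈ [α, β, γ, δ, s], z ≠ v (6 * r) ∧ z ≠ v (6 * r + 3) := by
    intro z hz
    rcases h3 z hz with h6 | h6
    · simp only [List.mem_cons, List.not_mem_nil, or_false] at h6
      grind
    · exact ⟨fun e => hW z h6 ⟨_, e.symm⟩, fun e => hW z h6 ⟨_, e.symm⟩⟩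
  refine LoosePath.two (p := α) (q := β) (z := s) (r := γ) (s := δ) h4 ?_ ?_ ?_
  · simpa only [← insert_empty_eq, Finset.insert_comm] using h5
  · simp only [List.mem_cons, List.not_mem_nil, or_false, not_or, List.nodup_cons,
      List.nodup_nil, not_false_eq_true, and_true, forall_eq_or_imp, forall_eq] at h1 h2 hne ⊢
    grind
  · intro z hz
    rcases h3 z (by simp at hz ⊢; tauto) with h6 | h6
    · simp only [List.mem_cons, List.not_mem_nil, or_false] at h6
      rcases h6 with rfl | rfl
      · exact Or.inl ⟨1, by omega, by omega, congrArg v (by ring)⟩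
      · exact Or.inl ⟨2, by omega, by omega, congrArg v (by ring)⟩
    · exact Or.inr fun ⟨j, hj⟩ => hW z h6 ⟨_, hj⟩

/-! ### Monochromatic triangles on twelve vertices -/

theorem LoosePath.one {c : Finset V → Prop} {x y p q : V} {S : Set V} (h : c {x, p, q, y})
    (hn : [x, p, q, y].Nodup) (hS : ∀ t ∈ [p, q], t ∈ S) : LoosePath c 1 x y S := by
  refine ⟨fun i => [x, p, q, y].getD i x, rfl, rfl, ?_, ?_, ?_⟩
  · intro i hi j hj e
    simp only at e
    rw [List.getD_eq_getElem _ _ (by simp; omega), List.getD_eq_getElem _ _ (by simp; omega)] at e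
    exact (hn.getElem_inj_iff).1 e
  · intro k hk
    interval_cases k
    exact h
  · intro i h0 hi
    interval_cases i <;> exact hS _ (by simp)

theorem exists_isCyc_three {c : Finset V → Prop} {x p q z r s y t u : V} (h1 : c {x, p, q, z})
    (h2 : c {z, r, s, y}) (h3 : c {x, t, u, y}) (hn : [x, p, q, z, r, s, y, t, u].Nodup) :
    ∃ v, IsCyc c 3 v := by
  simp only [List.mem_cons, List.not_mem_nil, or_false, not_or, List.nodup_cons,
      List.nodup_nil, not_false_eq_true, and_true] at hn
  refine (LoosePath.two (S := {a | a ∈ [p, q, z, r, s]}) h1 h2 (by simp; grind)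
    (by simp)).exists_isCyc_of_disjoint (LoosePath.one (S := {a | a ∈ [t, u]}) h3 (by simp; grind)
    (by simp)) (by omega) (by omega) ?_ ?_ ?_
  · simp; grind
  · simp; grind
  · simp only [List.mem_cons, List.not_mem_nil, or_false, Set.mem_ofPred_eq]
    grind

/-- Two red edges meeting only in `c` become a red triangle with any red edge that joins `a, b, d`
to `s₁, s₂, s₃` through two outside vertices. Three edges of this kind, all blue, form a triangle.
-/
theorem exists_blue_three_of_red {R : Finset V → Prop} {a b c d s₁ s₂ s₃ o₁ o₂ o₃ o₄ o₅ : V}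
    (hn : [a, b, c, d, s₁, s₂, s₃, o₁, o₂, o₃, o₄, o₅].Nodup) (h1 : R {a, b, c, d})
    (h2 : R {c, s₁, s₂, s₃}) (hno : ¬ ∃ v, IsCyc R 3 v) : ∃ v, IsCyc (fun e => ¬ R e) 3 v := by
  simp only [List.mem_cons, List.not_mem_nil, or_false, not_or, List.nodup_cons,
      List.nodup_nil, not_false_eq_true, and_true] at hn
  refine exists_isCyc_three (x := a) (p := o₁) (q := o₂) (z := s₁) (r := b) (s := o₅) (y := o₃)
    (t := s₂) (u := o₄) (fun h => hno ?_) (fun h => hno ?_) (fun h => hno ?_) ?_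
  · refine exists_isCyc_three (x := a) (p := b) (q := d) (z := c) (r := s₂) (s := s₃) (y := s₁)
      (t := o₁) (u := o₂) ?_ ?_ ?_ ?_
    · simpa only [← insert_empty_eq, Finset.insert_comm] using h1
    · simpa only [← insert_empty_eq, Finset.insert_comm] using h2
    · simpa only [← insert_empty_eq, Finset.insert_comm] using h
    · simp; grind
  · refine exists_isCyc_three (x := b) (p := a) (q := d) (z := c) (r := s₂) (s := s₃) (y := s₁)
      (t := o₅) (u := o₃) ?_ ?_ ?_ ?_
    · simpa only [← insert_empty_eq, Finset.insert_comm] using h1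
    · simpa only [← insert_empty_eq, Finset.insert_comm] using h2
    · simpa only [← insert_empty_eq, Finset.insert_comm] using h
    · simp; grind
  · refine exists_isCyc_three (x := a) (p := b) (q := d) (z := c) (r := s₁) (s := s₃) (y := s₂)
      (t := o₄) (u := o₃) ?_ ?_ ?_ ?_
    · simpa only [← insert_empty_eq, Finset.insert_comm] using h1
    · simpa only [← insert_empty_eq, Finset.insert_comm] using h2
    · simpa only [← insert_empty_eq, Finset.insert_comm] using h
    · simp; grind
  · simp; grind

/-- The three edges tested form a triangle, and each meets `{a, b, c, d}` in a single vertex. Either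
all are blue, or a red one provides the pair of red edges wanted above. -/
theorem exists_blue_three {R : Finset V → Prop} {a b c d s₁ s₂ s₃ o₁ o₂ o₃ o₄ o₅ : V}
    (hn : [a, b, c, d, s₁, s₂, s₃, o₁, o₂, o₃, o₄, o₅].Nodup) (h1 : R {a, b, c, d})
    (hno : ¬ ∃ v, IsCyc R 3 v) : ∃ v, IsCyc (fun e => ¬ R e) 3 v := by
  have hn' := hn
  simp only [List.mem_cons, List.not_mem_nil, or_false, not_or, List.nodup_cons,
      List.nodup_nil, not_false_eq_true, and_true] at hn'
  by_cases h2 : R {c, s₁, s₂, s₃}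
  · exact exists_blue_three_of_red hn h1 h2 hno
  by_cases h3 : R {c, o₁, o₂, o₃}
  · exact exists_blue_three_of_red (b := b) (o₁ := s₁) (o₂ := s₂) (o₃ := s₃) (o₄ := o₄) (o₅ := o₅)
      (by simp; grind) h1 h3 hno
  by_cases h4 : R {d, s₁, o₁, o₄}
  · exact exists_blue_three_of_red (a := a) (b := b) (c := d) (d := c) (o₁ := s₂) (o₂ := s₃)
      (o₃ := o₂) (o₄ := o₃) (o₅ := o₅) (by simp; grind)
      (by simpa only [← insert_empty_eq, Finset.insert_comm] using h1) h4 hno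
  refine exists_isCyc_three (x := s₁) (p := s₂) (q := s₃) (z := c) (r := o₂) (s := o₃) (y := o₁)
    (t := d) (u := o₄) (fun h => h2 ?_) (fun h => h3 ?_) (fun h => h4 ?_) ?_
  · simpa only [← insert_empty_eq, Finset.insert_comm] using h
  · simpa only [← insert_empty_eq, Finset.insert_comm] using h
  · simpa only [← insert_empty_eq, Finset.insert_comm] using h
  · simp; grind

theorem exists_mono_three [Fintype V] (R : Finset V → Prop) (hV : 12 ≤ Fintype.card V) :
    (∃ v, IsCyc R 3 v) ∨ ∃ v, IsCyc (fun e => ¬ R e) 3 v := by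
  obtain ⟨f⟩ : Nonempty (Fin 12 ↪ V) :=
    Function.Embedding.nonempty_of_card_le (by simpa using hV)
  have hn : (List.map f [0, 1, 2, 3, 4, 5, 6, 7, 8, 9, 10, 11]).Nodup :=
    List.Nodup.map f.injective (by decide)
  by_contra! hcon
  obtain ⟨h1, h2⟩ := hcon
  by_cases hR : R {f 0, f 1, f 2, f 3}
  · obtain ⟨v, hv⟩ := exists_blue_three hn hR fun ⟨v, hv⟩ => h1 v hv
    exact h2 v hv
  · obtain ⟨v, hv⟩ := exists_blue_three (R := fun e => ¬ R e) hn hR fun ⟨v, hv⟩ => h2 v hv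
    simp only [not_not] at hv
    exact h1 v hv

/-! ### Lengthening a cycle by one edge -/

theorem IsCyc.exists_succ [Fintype V] {R : Finset V → Prop} {m : ℕ} {v : ℤ → V}
    (h : IsCyc R m v) (hm : 3 ≤ m) (hV : 3 * (m + 1) + (m + 1) / 2 ≤ Fintype.card V) :
    (∃ v, IsCyc R (m + 1) v) ∨ ∃ v, IsCyc (fun e => ¬ R e) (m + 1) v := by
  by_contra hcon
  rw [not_or] at hcon
  set W : Finset V := Finset.univ \ (Finset.range (3 * m)).image fun j : ℕ => v j with hWdef
  have hcard : 3 + (m + 1) / 2 ≤ W.card := by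
    have h1 := Finset.le_card_sdiff ((Finset.range (3 * m)).image fun j : ℕ => v j) Finset.univ
    have h2 := Finset.card_image_le (s := Finset.range (3 * m)) (f := fun j : ℕ => v j)
    rw [Finset.card_range] at h2
    rw [Finset.card_univ, ← hWdef] at h1
    omega
  have hW : ∀ w ∈ W, w ∉ Set.range v := by
    rintro _ hw ⟨j, rfl⟩
    have h0 := Int.emod_nonneg j (show (3 * m : ℤ) ≠ 0 by omega)
    have h1 := Int.emod_lt_of_pos j (show (0 : ℤ) < 3 * m by omega)
    refine (Finset.mem_sdiff.1 hw).2 (Finset.mem_image.2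
      ⟨(j % (3 * m : ℤ)).toNat, Finset.mem_range.2 (by omega), ?_⟩)
    rw [Int.toNat_of_nonneg h0, h.1]
    exact Int.ModEq.dvd (Int.mod_modEq _ _).symm
  -- In both parities `3 + (m + 1) / 2 = r + 4`, and `3 ≤ m` gives `0 < r`.
  obtain ⟨r, rfl | rfl⟩ : ∃ r, m = 2 * r + 1 ∨ m = 2 * r + 2 := ⟨(m - 1) / 2, by omega⟩
  · exact h.false_of_odd (by omega) hcon.1 hcon.2 hW (by omega)
  · exact h.false_of_even (by omega) hcon.1 hcon.2 hW (by omega)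

theorem exists_mono [Fintype V] (R : Finset V → Prop) {n : ℕ} (hn : 4 ≤ n)
    (hV : 3 * n + n / 2 ≤ Fintype.card V) :
    (∃ v, IsCyc R n v) ∨ ∃ v, IsCyc (fun e => ¬ R e) n v := by
  have key : ∀ m, 3 ≤ m → m ≤ n → (∃ v, IsCyc R m v) ∨ ∃ v, IsCyc (fun e => ¬ R e) m v := by
    intro m hm
    induction m, hm using Nat.le_induction with
    | base => exact fun _ => exists_mono_three R (by omega)
    | succ m hm ih =>
      intro hmn
      rcases ih (by omega) with ⟨v, hv⟩ | ⟨v, hv⟩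
      · exact hv.exists_succ hm (by omega)
      · have := hv.exists_succ hm (by omega)
        simp only [not_not] at this
        exact this.symm
  exact key n (by omega) le_rfl

end LooseRamsey

/-! ### Transfer to hypergraphs and the extremal colouring -/

namespace LooseRamsey

open Hypergraph

theorem containsCopy_of_isCyc {N n : ℕ} (hn : 2 ≤ n) {c : (completeUniform 4 N).edgeSet → Bool}
    {b : Bool} {R : Finset (Fin N) → Prop}
    (hR : ∀ s : Finset (Fin N), s.card = 4 → R s →
      ∃ h : (s : Set (Fin N)) ∈ (completeUniform 4 N).edgeSet, c ⟨s, h⟩ = b)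
    {v : ℤ → Fin N} (h : IsCyc R n v) :
    ((completeUniform 4 N).colorClass c b).ContainsCopy (looseCycle 4 n) := by
  have hne : NeZero (n * (4 - 1)) := ⟨by omega⟩
  have hval : ∀ k : ℕ, v (((k : ℕ) : ZMod (n * (4 - 1))).val : ℤ) = v k := by
    intro k
    rw [h.1, ZMod.val_natCast]
    have := (Nat.mod_modEq k (n * (4 - 1))).symm
    rw [← Int.natCast_modEq_iff] at this
    have := this.dvd
    rwa [show ((n * (4 - 1) : ℕ) : ℤ) = 3 * n by push_cast; ring] at this
  refine ⟨fun z => v z.val, ?_, fun _ _ => Set.mem_univ _, ?_⟩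
  · intro z _ z' _ e
    have h1 := ZMod.val_lt z
    have h2 := ZMod.val_lt z'
    have := h.inj e (by omega) (by omega)
    exact ZMod.val_injective _ (by exact_mod_cast this)
  · rintro _ ⟨i, hi, rfl⟩
    have himg : (fun z : ZMod (n * (4 - 1)) => v z.val) ''
        {w | ∃ j < 4, w = ((i * (4 - 1) + j : ℕ) : ZMod (n * (4 - 1)))} =
        (({v (3 * (i : ℤ)), v (3 * (i : ℤ) + 1), v (3 * (i : ℤ) + 2), v (3 * (i : ℤ) + 3)} :
          Finset (Fin N)) : Set (Fin N)) := by
      have hv : ∀ j : ℕ, v (((i * (4 - 1) + j : ℕ) : ZMod (n * (4 - 1))).val : ℤ) =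
          v (3 * (i : ℤ) + j) := fun j => by
        rw [hval]
        push_cast
        congr 1
        ring
      ext w
      simp only [Set.mem_image, Finset.coe_insert, Finset.coe_singleton, Set.mem_insert_iff,
        Set.mem_singleton_iff]
      constructor
      · rintro ⟨_, ⟨j, hj, rfl⟩, rfl⟩
        rw [hv]
        interval_cases j <;> simp
      · rintro (rfl | rfl | rfl | rfl)
        · exact ⟨_, ⟨0, by omega, rfl⟩, (hv 0).trans (by simp)⟩
        · exact ⟨_, ⟨1, by omega, rfl⟩, (hv 1).trans (by simp)⟩
        · exact ⟨_, ⟨2, by omega, rfl⟩, (hv 2).trans (by simp)⟩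
        · exact ⟨_, ⟨3, by omega, rfl⟩, (hv 3).trans (by simp)⟩
    rw [himg]
    refine hR _ ?_ (h.2 i)
    have h1 : ∀ a b : ℤ, a ≠ b → a - b < 6 → b - a < 6 → v a ≠ v b := fun a b hab _ _ =>
      h.ne hab (by omega) (by omega)
    rw [Finset.card_insert_of_notMem, Finset.card_insert_of_notMem, Finset.card_insert_of_notMem,
      Finset.card_singleton]
    · simpa using h1 _ _ (by omega) (by omega) (by omega)
    · simp only [Finset.mem_insert, Finset.mem_singleton, not_or]
      exact ⟨h1 _ _ (by omega) (by omega) (by omega), h1 _ _ (by omega) (by omega) (by omega)⟩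
    · simp only [Finset.mem_insert, Finset.mem_singleton, not_or]
      exact ⟨h1 _ _ (by omega) (by omega) (by omega), h1 _ _ (by omega) (by omega) (by omega),
        h1 _ _ (by omega) (by omega) (by omega)⟩

theorem arrows_looseCycle {n : ℕ} (hn : 4 ≤ n) :
    Arrows 4 (3 * n + n / 2) (looseCycle 4 n) (looseCycle 4 n) := by
  intro c
  have hmem : ∀ s : Finset (Fin (3 * n + n / 2)), s.card = 4 →
      (s : Set (Fin (3 * n + n / 2))) ∈ (completeUniform 4 (3 * n + n / 2)).edgeSet := by
    intro s hs
    change (s : Set (Fin (3 * n + n / 2))).ncard = 4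
    rw [Set.ncard_coe_finset, hs]
  rcases exists_mono (fun s : Finset (Fin (3 * n + n / 2)) =>
    ∃ h : (s : Set (Fin (3 * n + n / 2))) ∈ (completeUniform 4 (3 * n + n / 2)).edgeSet,
      c ⟨s, h⟩ = true) hn (by simp) with ⟨v, hv⟩ | ⟨v, hv⟩
  · exact Or.inl (containsCopy_of_isCyc (by omega) (fun s _ h => h) hv)
  · refine Or.inr (containsCopy_of_isCyc (by omega) (fun s hs h => ⟨hmem s hs, ?_⟩) hv)
    by_contra hc
    exact h ⟨hmem s hs, by simpa using hc⟩

theorem not_arrows_looseCycle {N n : ℕ} (hn : 2 ≤ n) (hN : N < 3 * n + (n - 1) / 2) :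
    ¬ Arrows 4 N (looseCycle 4 n) (looseCycle 4 n) := by
  classical
  have hne : NeZero (n * (4 - 1)) := ⟨by omega⟩
  intro hA
  -- Red edges are those avoiding the first `(n - 1) / 2` vertices.
  rcases hA fun e => decide (∀ x ∈ e.1, (n - 1) / 2 ≤ (x : ℕ)) with ⟨f, hf, -, he⟩ | ⟨f, hf, -, he⟩
  · have hlarge : ∀ z, (n - 1) / 2 ≤ (f z : ℕ) := by
      intro z
      have hz := ZMod.val_lt z
      obtain ⟨_, hc⟩ := he _ ⟨z.val / 3, by omega, rfl⟩
      refine of_decide_eq_true hc (f z) ⟨z, ⟨z.val % 3, by omega, ?_⟩, rfl⟩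
      rw [show z.val / 3 * (4 - 1) + z.val % 3 = z.val by omega, ZMod.natCast_zmod_val]
    have hinj : Function.Injective fun z : ZMod (n * (4 - 1)) =>
        (⟨(f z : ℕ) - (n - 1) / 2, by have := (f z).2; have := hlarge z; omega⟩ :
          Fin (N - (n - 1) / 2)) := by
      intro z z' e
      have e := congrArg Fin.val e
      simp only at e
      have h1 := hlarge z
      have h2 := hlarge z'
      exact hf (Set.mem_univ _) (Set.mem_univ _) (Fin.ext (by omega))
    have := Fintype.card_le_of_injective _ hinj
    rw [ZMod.card, Fintype.card_fin] at this
    omega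
  · have hsmall : ∀ i : Fin n, ∃ j < 4, (f ((i * (4 - 1) + j : ℕ) : ZMod (n * (4 - 1))) : ℕ) <
        (n - 1) / 2 := by
      intro i
      obtain ⟨_, hc⟩ := he _ ⟨i, i.2, rfl⟩
      have := of_decide_eq_false hc
      push Not at this
      obtain ⟨_, ⟨_, ⟨j, hj, rfl⟩, rfl⟩, hx⟩ := this
      exact ⟨j, hj, hx⟩
    choose j hj hlt using hsmall
    -- A vertex lies in two edges only as the last vertex of one and the first of the next. Hence
    -- the chosen small vertex, together with whether it is the last one of its edge, determines the
    -- edge.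
    have hinj : Function.Injective fun i : Fin n =>
        ((⟨_, hlt i⟩ : Fin ((n - 1) / 2)), decide (j i = 3)) := by
      intro i i' e
      simp only [Prod.mk.injEq, Fin.mk.injEq, decide_eq_decide] at e
      have e1 := hf (Set.mem_univ _) (Set.mem_univ _) (Fin.ext e.1)
      rw [ZMod.natCast_eq_natCast_iff] at e1
      have h1 := hj i
      have h2 := hj i'
      have h3 := e.2
      have h4 := i.2
      have h5 := i'.2
      refine Fin.ext ?_
      by_cases h6 : j i = 3
      · have h7 := h3.1 h6
        rw [h6, h7] at e1
        have := Nat.ModEq.add_right_cancel' 3 e1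
        have := Nat.ModEq.eq_of_lt_of_lt this (by omega) (by omega)
        omega
      · have h7 : j i' ≠ 3 := fun h => h6 (h3.2 h)
        have := Nat.ModEq.eq_of_lt_of_lt e1 (by omega) (by omega)
        omega
    have := Fintype.card_le_of_injective _ hinj
    simp only [Fintype.card_fin, Fintype.card_prod, Fintype.card_bool] at this
    omega

end LooseRamsey

theorem mainTheorem3 (n : ℕ) (hn : 4 ≤ n) :
    (Odd n →
      Hypergraph.ramseyNumber 4 (Hypergraph.looseCycle 4 n) (Hypergraph.looseCycle 4 n) =
        3 * n + (n - 1) / 2) ∧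
    (Even n →
      3 * n + (n - 1) / 2 ≤
        Hypergraph.ramseyNumber 4 (Hypergraph.looseCycle 4 n) (Hypergraph.looseCycle 4 n) ∧
      Hypergraph.ramseyNumber 4 (Hypergraph.looseCycle 4 n) (Hypergraph.looseCycle 4 n) ≤
        3 * n + (n - 1) / 2 + 1) := by
  have hupper : Hypergraph.ramseyNumber 4 (Hypergraph.looseCycle 4 n) (Hypergraph.looseCycle 4 n) ≤
      3 * n + n / 2 :=
    Nat.sInf_le ⟨by omega, LooseRamsey.arrows_looseCycle hn⟩
  have hlower : 3 * n + (n - 1) / 2 ≤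
      Hypergraph.ramseyNumber 4 (Hypergraph.looseCycle 4 n) (Hypergraph.looseCycle 4 n) := by
    refine le_csInf ⟨_, by omega, LooseRamsey.arrows_looseCycle hn⟩ fun N hN => ?_
    by_contra! hlt
    exact LooseRamsey.not_arrows_looseCycle (by omega) hlt hN.2
  refine ⟨fun ⟨k, hk⟩ => ?_, fun ⟨k, hk⟩ => ⟨hlower, ?_⟩⟩ <;> omega
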